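/- A simple drawing of the complete bipartite graph $K_{m,n}$ ($m,n\ge 1$) maps the vertices to distinct points of the plane and the edges to non-self-intersecting continuous curves joining their endpoints, so that no edge passes through a vertex other than its endpoints and any two edges have at most one common point, which is either a common endpoint or a proper crossing in the relative interior of both. The drawing is monotone if every edge is an $x$-monotone curve, that is, meets every vertical line in at most one point. A shooting star rooted at a vertex $r$ is a set of edges that forms a spanning tree of $K_{m,n}$, contains all edges incident to $r$, has height at most $2$ as a tree rooted at $r$, and contains no two edges that cross. Suppose that a monotone drawing of $K_{m,n}$ is given by its rotation system (the clockwise cyclic order of the edges around each vertex), the crossings sorted along each edge, and the vertices sorted by $x$-coordinate (ties, which can occur only within one class of the bipartition, being broken arbitrarily). Then a shooting star can be computed in time linear in the size of the input: there are a single program for a word RAM (unit-cost instructions: constants, addition, truncated subtraction, comparison, indirect load and store) and a constant $C$ such that, for all $m,n\ge 1$ and every such input, consisting of $N$ words, the program halts after at most $CN$ steps, computes only with numbers smaller than $CN$, and outputs the list of edges of a shooting star in the drawing. This shooting star is rooted at the leftmost vertex (the first vertex of the given order). -/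

import Mathlib

open scoped Topology unitInterval

/-! ### Drawings of complete bipartite graphs in the plane -/

/-- The vertices of `K_{m,n}`: `m` red vertices and `n` blue vertices. -/
abbrev BVertex (m n : ℕ) : Type := Fin m ⊕ Fin n

/-- The edges of `K_{m,n}`: the pair `(i, j)` joins the red vertex `i` to the blue vertex `j`. -/
abbrev BEdge (m n : ℕ) : Type := Fin m × Fin n

/-- `v` is an endpoint of the edge `e`. -/
def BIncident {m n : ℕ} (e : BEdge m n) (v : BVertex m n) : Prop :=
  v = Sum.inl e.1 ∨ v = Sum.inr e.2

/-- A drawing of `K_{m,n}` in the plane: a point for every vertex, and for every edge a continuous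
curve (parametrised by the unit interval) from its red to its blue endpoint. -/
structure BDrawing (m n : ℕ) where
  pt : BVertex m n → ℝ × ℝ
  curve : (e : BEdge m n) → Path (pt (Sum.inl e.1)) (pt (Sum.inr e.2))

/-- The point sets `A` and `B` (two curves) cross properly at `p`: some neighbourhood of `p` is
mapped homeomorphically onto an open subset of the plane in such a way that `A` becomes the
horizontal axis and `B` the vertical axis. -/
def IsProperCrossing (A B : Set (ℝ × ℝ)) (p : ℝ × ℝ) : Prop :=
  p ∈ A ∧ p ∈ B ∧
    ∃ φ : OpenPartialHomeomorph (ℝ × ℝ) (ℝ × ℝ), p ∈ φ.source ∧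
      ∀ q ∈ φ.source, (q ∈ A ↔ (φ q).2 = 0) ∧ (q ∈ B ↔ (φ q).1 = 0)

/-- Simple drawings. -/
structure BDrawing.IsSimple {m n : ℕ} (D : BDrawing m n) : Prop where
  /-- The vertices are distinct points. -/
  pt_injective : Function.Injective D.pt
  /-- The edges do not intersect themselves. -/
  curve_injective : ∀ e, Function.Injective (D.curve e)
  /-- No edge passes through a vertex that is not one of its endpoints. -/
  avoids_vertices : ∀ e t v, D.curve e t = D.pt v → BIncident e v
  /-- Two edges have at most one point in common. -/
  meet_once : ∀ e f, e ≠ f → ∀ s t s' t', D.curve e s = D.curve f t →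
    D.curve e s' = D.curve f t' → D.curve e s = D.curve e s'
  /-- A common point of two edges is a common endpoint, or it lies in the relative interior of
  both and is a proper crossing. -/
  meet_properly : ∀ e f, e ≠ f → ∀ s t, D.curve e s = D.curve f t →
    (∃ v, BIncident e v ∧ BIncident f v ∧ D.curve e s = D.pt v) ∨
    (s ∈ Set.Ioo (0 : I) 1 ∧ t ∈ Set.Ioo (0 : I) 1 ∧
      IsProperCrossing (Set.range (D.curve e)) (Set.range (D.curve f)) (D.curve e s))

/-- All edges are `x`-monotone curves: every vertical line meets an edge in at most one point. -/
def BDrawing.IsXMonotone {m n : ℕ} (D : BDrawing m n) : Prop :=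
  ∀ e s t, (D.curve e s).1 = (D.curve e t).1 → D.curve e s = D.curve e t

/-- The edges `e` and `f` cross: they are distinct and their relative interiors meet. -/
def BDrawing.Crosses {m n : ℕ} (D : BDrawing m n) (e f : BEdge m n) : Prop :=
  e ≠ f ∧ ∃ s ∈ Set.Ioo (0 : I) 1, ∃ t ∈ Set.Ioo (0 : I) 1, D.curve e s = D.curve f t

/-! ### Shooting stars -/

/-- The spanning subgraph of `K_{m,n}` with edge set `S`. -/
def bipartiteSubgraph {m n : ℕ} (S : Set (BEdge m n)) : SimpleGraph (BVertex m n) :=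
  SimpleGraph.fromEdgeSet {a | ∃ e ∈ S, a = s(Sum.inl e.1, Sum.inr e.2)}

/-- The edges in `S` form a shooting star rooted at `r` in the drawing `D`: a plane spanning tree
that contains the star of `r` and has, as a tree rooted at `r`, height at most two. -/
structure BDrawing.IsShootingStar {m n : ℕ} (D : BDrawing m n) (r : BVertex m n)
    (S : Set (BEdge m n)) : Prop where
  isTree : (bipartiteSubgraph S).IsTree
  star_subset : ∀ e, BIncident e r → e ∈ S
  height_le : ∀ v, (bipartiteSubgraph S).dist r v ≤ 2
  plane : ∀ e ∈ S, ∀ f ∈ S, ¬ D.Crosses e f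

/-! ### The input: a combinatorial description of a drawing -/

/-- The curve `γ` leaves the disk of radius `ε` around its starting point for the first time in
the direction with polar angle `θ`. -/
def LeavesDiskAt (γ : I → ℝ × ℝ) (ε θ : ℝ) : Prop :=
  ∃ t : I, γ t = γ 0 + (ε * Real.cos θ, ε * Real.sin θ) ∧
    ∀ s < t, ((γ s).1 - (γ 0).1) ^ 2 + ((γ s).2 - (γ 0).2) ^ 2 < ε ^ 2

/-- The list `L` of curves with a common starting point is in clockwise cyclic order around that
point: on every sufficiently small circle around it, the points at which the curves first leave the
disk follow each other in clockwise order within one turn. -/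
def IsClockwise (L : List (I → ℝ × ℝ)) : Prop :=
  ∀ᶠ ε in 𝓝[>] (0 : ℝ), ∃ θ : Fin L.length → ℝ, StrictAnti θ ∧
    (∀ a b, θ a - θ b < 2 * Real.pi) ∧ ∀ k, LeavesDiskAt (L.get k) ε (θ k)

/-- Data of the kind that describes a drawing of `K_{m,n}` combinatorially. -/
structure BDrawingData (m n : ℕ) where
  /-- The vertices, sorted by `x`-coordinate. -/
  order : List (BVertex m n)
  /-- The rotation at a red vertex, each edge being named by its blue endpoint. -/
  rotRed : Fin m → List (Fin n)
  /-- The rotation at a blue vertex, each edge being named by its red endpoint. -/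
  rotBlue : Fin n → List (Fin m)
  /-- The crossings on an edge, sorted from its red to its blue endpoint, each crossing being
  named by the other edge. -/
  crossings : BEdge m n → List (BEdge m n)

/-- The data describe the drawing `D`. -/
structure BDrawingData.Describes {m n : ℕ} (X : BDrawingData m n) (D : BDrawing m n) : Prop where
  order_nodup : X.order.Nodup
  mem_order : ∀ v, v ∈ X.order
  order_sorted : X.order.Pairwise fun u v => (D.pt u).1 ≤ (D.pt v).1
  rotRed_nodup : ∀ i, (X.rotRed i).Nodup
  mem_rotRed : ∀ i j, j ∈ X.rotRed i
  rotRed_clockwise : ∀ i, IsClockwise ((X.rotRed i).map fun j => ⇑(D.curve (i, j)))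
  rotBlue_nodup : ∀ j, (X.rotBlue j).Nodup
  mem_rotBlue : ∀ j i, i ∈ X.rotBlue j
  rotBlue_clockwise : ∀ j, IsClockwise ((X.rotBlue j).map fun i => ⇑(D.curve (i, j)).symm)
  crossings_nodup : ∀ e, (X.crossings e).Nodup
  mem_crossings : ∀ e f, f ∈ X.crossings e ↔ D.Crosses e f
  crossings_sorted : ∀ e, (X.crossings e).Pairwise fun f g =>
    ∀ s s' t t', D.curve e s = D.curve f s' → D.curve e t = D.curve g t' → s ≤ t

/-- A vertex as a number: `0, …, m - 1` are the red vertices, `m, …, m + n - 1` the blue ones. -/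
def vertexCode {m n : ℕ} : BVertex m n → ℕ
  | Sum.inl i => i
  | Sum.inr j => m + j

/-- A list of edges as a list of numbers, two for each edge. -/
def edgeListCode {m n : ℕ} (L : List (BEdge m n)) : List ℕ :=
  L.flatMap fun e => [(e.1 : ℕ), (e.2 : ℕ)]

/-- The data as a list of numbers: `m` and `n`, the sorted vertices, the rotations at the red and
at the blue vertices, and, edge by edge, the number of crossings followed by their list. -/
def BDrawingData.code {m n : ℕ} (X : BDrawingData m n) : List ℕ :=
  [m, n] ++ X.order.map vertexCode
    ++ (List.finRange m).flatMap (fun i => (X.rotRed i).map fun j => (j : ℕ))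
    ++ (List.finRange n).flatMap (fun j => (X.rotBlue j).map fun i => (i : ℕ))
    ++ (List.finRange m).flatMap fun i => (List.finRange n).flatMap fun j =>
        (X.crossings (i, j)).length :: edgeListCode (X.crossings (i, j))

/-! ### A word random access machine with step count -/

/-- The contents of the registers and of the memory. -/
structure RamState where
  reg : ℕ → ℕ
  mem : ℕ → ℕ

/-- The state after writing `x` to register `r`. -/
def RamState.setReg (s : RamState) (r x : ℕ) : RamState :=
  { s with reg := Function.update s.reg r x }

/-- The state after writing `x` to the memory cell `a`. -/
def RamState.setMem (s : RamState) (a x : ℕ) : RamState :=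
  { s with mem := Function.update s.mem a x }

/-- Structured programs of the machine; the numbers `r`, `a`, `b` name registers. -/
inductive RamProg : Type
  /-- do nothing -/
  | skip : RamProg
  /-- `reg r := k` -/
  | const (r k : ℕ) : RamProg
  /-- `reg r := reg a + reg b` -/
  | plus (r a b : ℕ) : RamProg
  /-- `reg r := reg a - reg b`, or zero if this is negative -/
  | minus (r a b : ℕ) : RamProg
  /-- `reg r := mem (reg a)` -/
  | load (r a : ℕ) : RamProg
  /-- `mem (reg a) := reg b` -/
  | store (a b : ℕ) : RamProg
  /-- `p; q` -/
  | seq (p q : RamProg) : RamProg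
  /-- if `reg a < reg b` then `p` else `q` -/
  | ifLt (a b : ℕ) (p q : RamProg) : RamProg
  /-- while `reg a < reg b` do `p` -/
  | whileLt (a b : ℕ) (p : RamProg) : RamProg

/-- `RamExec W p s t s'`: on a machine whose words are the numbers below `W`, the program `p`
started in the state `s` halts in the state `s'` after exactly `t` steps. Every elementary
instruction and every evaluation of a test takes one step; a computed number that does not fit into
a word makes the machine fail. -/
inductive RamExec (W : ℕ) : RamProg → RamState → ℕ → RamState → Prop
  | skip (s : RamState) : RamExec W RamProg.skip s 1 s
  | const (s : RamState) (r k : ℕ) (h : k < W) :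
      RamExec W (RamProg.const r k) s 1 (s.setReg r k)
  | plus (s : RamState) (r a b : ℕ) (h : s.reg a + s.reg b < W) :
      RamExec W (RamProg.plus r a b) s 1 (s.setReg r (s.reg a + s.reg b))
  | minus (s : RamState) (r a b : ℕ) :
      RamExec W (RamProg.minus r a b) s 1 (s.setReg r (s.reg a - s.reg b))
  | load (s : RamState) (r a : ℕ) :
      RamExec W (RamProg.load r a) s 1 (s.setReg r (s.mem (s.reg a)))
  | store (s : RamState) (a b : ℕ) :
      RamExec W (RamProg.store a b) s 1 (s.setMem (s.reg a) (s.reg b))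
  | seq {p q : RamProg} {s s' s'' : RamState} {t t' : ℕ}
      (hp : RamExec W p s t s') (hq : RamExec W q s' t' s'') :
      RamExec W (RamProg.seq p q) s (t + t') s''
  | ifLt_true {a b : ℕ} {p q : RamProg} {s s' : RamState} {t : ℕ}
      (h : s.reg a < s.reg b) (hp : RamExec W p s t s') :
      RamExec W (RamProg.ifLt a b p q) s (1 + t) s'
  | ifLt_false {a b : ℕ} {p q : RamProg} {s s' : RamState} {t : ℕ}
      (h : ¬ s.reg a < s.reg b) (hq : RamExec W q s t s') :
      RamExec W (RamProg.ifLt a b p q) s (1 + t) s'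
  | whileLt_true {a b : ℕ} {p : RamProg} {s s' s'' : RamState} {t t' : ℕ}
      (h : s.reg a < s.reg b) (hp : RamExec W p s t s')
      (hw : RamExec W (RamProg.whileLt a b p) s' t' s'') :
      RamExec W (RamProg.whileLt a b p) s (1 + t + t') s''
  | whileLt_false {a b : ℕ} {p : RamProg} {s : RamState} (h : ¬ s.reg a < s.reg b) :
      RamExec W (RamProg.whileLt a b p) s 1 s

/-- The state in which the machine is started on the input `l`: the input is in the first memory
cells, its length is in register `0`, and everything else is zero. -/
def RamState.start (l : List ℕ) : RamState where
  reg := fun r => if r = 0 then l.length else 0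
  mem := fun a => l.getD a 0

/-- The output in a final state: register `0` holds the address of its first word and register `1`
its length. -/
def RamState.output (s : RamState) : List ℕ :=
  (List.range (s.reg 1)).map fun k => s.mem (s.reg 0 + k)

/-! Let `r` be the leftmost vertex. Every vertex `i ≠ r` in the class of `r` is joined to the first
vertex of the other class to its right whose edge to `i` crosses no edge at `r` (a clear edge). If
there is no such vertex, `i` is joined to the last vertex of the other class. Together with the star
of `r` these edges form a tree of height at most two, and the point is that no two of them cross.

The star edges keep one vertical order to the right of `r`. If some vertex of the other class lies
to the right of `i`, consider the star edges that reach beyond `i`, in particular the uppermost one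
below `i` and the lowest one above `i`. The edge from `i` to the endpoint of whichever of these two
ends first is confined between them, hence clear (`clear_of_extremal`). Moreover, this endpoint
comes no later than any vertex `b'` to the right of `i` that lies on the same side as `i` of all
other star edges reaching `b'` (`exists_clear`).

Suppose that two chosen edges `v b` and `w b'` leading to the right cross, with `b` before `b'`.
Following one edge forward and the other backward from the crossing shows that `b` and `w` lie on
the same side of the star edges (`sameSide_of_cross`). So `w` has a clear edge ending no later than
`b`, and `b'` was not the first choice (`plane_of_choice`). A vertex with no clear edge to the right
lies beyond the whole other class, so its default edge stays clear of all edges leading to the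
right.

Topology enters only in passing from curves to height functions: simplicity yields that two edges
meet at most once and never merely touch (`not_isProperCrossing_of_lt`).

For the running time, one pass over the lists of crossings decides which edges are clear and keeps,
for every vertex, the smallest position of an admissible neighbour. The rotations alone contribute
`2 * m * n` words to the input, so a constant amount of work per edge is affordable, and scanning a
list is charged to its own length. `wp_program` records the cost and the output; `Describes.input`
and `Describes.hit_iff` connect memory contents with the drawing. -/

/-- Two continuous functions that differ throughout an interval keep their order. -/
theorem lt_iff_lt_of_ne_on_Icc {f g : ℝ → ℝ} {a b : ℝ} (hab : a ≤ b)
    (hf : ContinuousOn f (Set.Icc a b)) (hg : ContinuousOn g (Set.Icc a b))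
    (hne : ∀ x ∈ Set.Icc a b, f x ≠ g x) : f a < g a ↔ f b < g b := by
  have key : ∀ {u v : ℝ → ℝ}, ContinuousOn u (Set.Icc a b) → ContinuousOn v (Set.Icc a b) →
      (∀ x ∈ Set.Icc a b, u x ≠ v x) → u a < v a → u b < v b := by
    intro u v hu hv h hlt
    by_contra hc
    obtain ⟨x, hx, hx0⟩ := intermediate_value_Icc hab (hu.sub hv)
      (show (0 : ℝ) ∈ Set.Icc _ _ from ⟨sub_nonpos.2 hlt.le, sub_nonneg.2 (not_lt.1 hc)⟩)
    exact h x hx (sub_eq_zero.1 hx0)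
  refine ⟨key hf hg hne, fun h => ?_⟩
  by_contra hc
  have h1 : g a < f a := lt_of_le_of_ne (not_lt.1 hc) (hne a ⟨le_rfl, hab⟩).symm
  exact lt_asymm h (key hg hf (fun x hx => (hne x hx).symm) h1)

/-! ### Combinatorics of monotone drawings, expressed through height functions -/

/-- A drawing of a complete bipartite graph with `x`-monotone edges, each edge being given by the
height function on the interval between the `x`-coordinates of its endpoints. -/
structure MonoFamily (ι κ : Type*) where
  X : ι → ℝ
  Y : κ → ℝ
  hX : ι → ℝ
  hY : κ → ℝ
  F : ι → κ → ℝ → ℝ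
  ne : ∀ i j, X i ≠ Y j
  cont : ∀ i j, ContinuousOn (F i j) (Set.uIcc (X i) (Y j))
  F_X : ∀ i j, F i j (X i) = hX i
  F_Y : ∀ i j, F i j (Y j) = hY j
  avoidX : ∀ i j i', i' ≠ i → X i' ∈ Set.uIcc (X i) (Y j) → F i j (X i') ≠ hX i'
  avoidY : ∀ i j j', j' ≠ j → Y j' ∈ Set.uIcc (X i) (Y j) → F i j (Y j') ≠ hY j'
  once : ∀ i j i' j', (i, j) ≠ (i', j') → ∀ x y,
    x ∈ Set.uIcc (X i) (Y j) → x ∈ Set.uIcc (X i') (Y j') →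
    y ∈ Set.uIcc (X i) (Y j) → y ∈ Set.uIcc (X i') (Y j') →
    F i j x = F i' j' x → F i j y = F i' j' y → x = y
  proper : ∀ i j i' j', (i, j) ≠ (i', j') → ∀ x,
    x ∈ Set.uIoo (X i) (Y j) → x ∈ Set.uIoo (X i') (Y j') → F i j x = F i' j' x →
    ¬ ∀ᶠ z in 𝓝[≠] x, F i j z < F i' j' z

namespace MonoFamily

variable {ι κ : Type*} (A : MonoFamily ι κ)

/-- Two distinct edges cross: they meet over the interiors of their intervals. -/
def Cross (i : ι) (j : κ) (i' : ι) (j' : κ) : Prop :=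
  (i, j) ≠ (i', j') ∧ ∃ x, x ∈ Set.uIoo (A.X i) (A.Y j) ∧ x ∈ Set.uIoo (A.X i') (A.Y j') ∧
    A.F i j x = A.F i' j' x

/-- The mirror image in the horizontal axis. -/
def neg : MonoFamily ι κ where
  X := A.X
  Y := A.Y
  hX := fun i => - A.hX i
  hY := fun j => - A.hY j
  F := fun i j x => - A.F i j x
  ne := A.ne
  cont := fun i j => (A.cont i j).neg
  F_X := fun i j => by rw [A.F_X]
  F_Y := fun i j => by rw [A.F_Y]
  avoidX := fun i j i' h hx => by simpa using A.avoidX i j i' h hx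
  avoidY := fun i j i' h hx => by simpa using A.avoidY i j i' h hx
  once := fun i j i' j' h x y h1 h2 h3 h4 h5 h6 =>
    A.once i j i' j' h x y h1 h2 h3 h4 (by simpa using h5) (by simpa using h6)
  proper := fun i j i' j' h x h1 h2 h3 => by
    have := A.proper i' j' i j h.symm x h2 h1 (by simpa using h3.symm)
    simpa using this

theorem neg_cross {i : ι} {j : κ} {i' : ι} {j' : κ} : A.neg.Cross i j i' j' ↔ A.Cross i j i' j' := by
  simp [Cross, neg]

variable {A}

theorem Cross.symm {i : ι} {j : κ} {i' : ι} {j' : κ} (h : A.Cross i j i' j') :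
    A.Cross i' j' i j :=
  let ⟨hne, x, h1, h2, h3⟩ := h
  ⟨hne.symm, x, h2, h1, h3.symm⟩

theorem mem_uIcc_of_mem_uIoo {a b x : ℝ} (h : x ∈ Set.uIoo a b) : x ∈ Set.uIcc a b :=
  ⟨h.1.le, h.2.le⟩

/-- The shared endpoint already uses up the only common point that `once` allows. -/
theorem not_cross_left (i : ι) (j j' : κ) : ¬ A.Cross i j i j' := by
  rintro ⟨hne, x, h1, h2, h3⟩
  have := A.once i j i j' hne x (A.X i) (mem_uIcc_of_mem_uIoo h1) (mem_uIcc_of_mem_uIoo h2)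
    (by simp) (by simp) h3 (by rw [A.F_X, A.F_X])
  subst this
  rcases le_total (A.X i) (A.Y j) with h | h <;> simp [Set.uIoo, h] at h1

theorem not_cross_right (i i' : ι) (j : κ) : ¬ A.Cross i j i' j := by
  rintro ⟨hne, x, h1, h2, h3⟩
  have := A.once i j i' j hne x (A.Y j) (mem_uIcc_of_mem_uIoo h1) (mem_uIcc_of_mem_uIoo h2)
    (by simp) (by simp) h3 (by rw [A.F_Y, A.F_Y])
  subst this
  rcases le_total (A.X i) (A.Y j) with h | h <;> simp [Set.uIoo, h] at h1

/-- Two edges with the same order at both ends of a common interval do not meet in between. -/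
theorem lt_of_lt_ends {i : ι} {j : κ} {i' : ι} {j' : κ} (hne : (i, j) ≠ (i', j')) {a c : ℝ}
    (h1 : Set.Icc a c ⊆ Set.uIcc (A.X i) (A.Y j)) (h2 : Set.Icc a c ⊆ Set.uIcc (A.X i') (A.Y j'))
    (ha : A.F i j a < A.F i' j' a) (hc : A.F i j c < A.F i' j' c) {x : ℝ}
    (hx : x ∈ Set.Icc a c) : A.F i j x < A.F i' j' x := by
  by_contra hcon
  have c1 : ContinuousOn (A.F i j) (Set.Icc a c) := (A.cont i j).mono h1
  have c2 : ContinuousOn (A.F i' j') (Set.Icc a c) := (A.cont i' j').mono h2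
  have hax : Set.Icc a x ⊆ Set.Icc a c := Set.Icc_subset_Icc le_rfl hx.2
  obtain ⟨y, hy, hy0⟩ := intermediate_value_Icc hx.1 ((c1.mono hax).sub (c2.mono hax))
      (show (0 : ℝ) ∈ Set.Icc _ _ from ⟨sub_nonpos.2 ha.le, sub_nonneg.2 (not_lt.1 hcon)⟩)
  have hy0 : A.F i j y = A.F i' j' y := sub_eq_zero.1 hy0
  have hyc : y ∈ Set.Icc a c := hax hy
  have hay : a < y := lt_of_le_of_ne hyc.1 (by rintro rfl; exact ha.ne hy0)
  have hcy : y < c := lt_of_le_of_ne hyc.2 (by rintro rfl; exact hc.ne hy0)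
  have hac : a ≤ c := hx.1.trans hx.2
  -- By `once`, `y` is the only meeting point, so the order at each end of the interval persists up
  -- to `y`. The edges would then touch at `y` from one side, contrary to `proper`.
  have hother : ∀ z ∈ Set.Icc a c, z ≠ y → A.F i j z ≠ A.F i' j' z := fun z hz hzy h =>
    hzy (A.once i j i' j' hne z y (h1 hz) (h2 hz) (h1 hyc) (h2 hyc) h hy0)
  have hlt : ∀ z ∈ Set.Icc a c, z ≠ y → A.F i j z < A.F i' j' z := by
    intro z hz hzy
    rcases lt_or_gt_of_ne hzy with h | h
    · have hs : Set.Icc a z ⊆ Set.Icc a c := Set.Icc_subset_Icc le_rfl hz.2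
      exact (lt_iff_lt_of_ne_on_Icc hz.1 (c1.mono hs) (c2.mono hs)
        fun w hw => hother w (hs hw) (hw.2.trans_lt h).ne).1 ha
    · have hs : Set.Icc z c ⊆ Set.Icc a c := Set.Icc_subset_Icc hz.1 le_rfl
      exact (lt_iff_lt_of_ne_on_Icc hz.2 (c1.mono hs) (c2.mono hs)
        fun w hw => hother w (hs hw) (h.trans_le hw.1).ne').2 hc
  have hin : ∀ {p q : ℝ}, Set.Icc a c ⊆ Set.uIcc p q → y ∈ Set.uIoo p q := fun h =>
    ⟨(h ⟨le_rfl, hac⟩).1.trans_lt hay, hcy.trans_le (h ⟨hac, le_rfl⟩).2⟩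
  refine A.proper i j i' j' hne y (hin h1) (hin h2) hy0 ?_
  filter_upwards [nhdsWithin_le_nhds (Icc_mem_nhds hay hcy), self_mem_nhdsWithin] with z hz hz'
  exact hlt z hz hz'

variable (A) in
/-- The edge from `i` to `j` crosses no edge at `r`. -/
def Clear (r i : ι) (j : κ) : Prop := ∀ j', ¬ A.Cross i j r j'

variable (A) in
/-- For the edges at `r` that reach at least as far as `j`, the side on which `i` lies is the side
on which `j` lies. -/
def SameSide (r i : ι) (j : κ) : Prop :=
  ∀ c, c ≠ j → A.Y j ≤ A.Y c →
    (A.F r c (A.X i) < A.hX i ↔ A.F r c (A.Y j) < A.hY j)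

section Star

variable {r : ι} (hrX : ∀ i, A.X r ≤ A.X i) (hrY : ∀ j, A.X r < A.Y j)
include hrX hrY

/-- Over `[X i, p]` the two edges never meet: at `X i` the star edge avoids the vertex `i`, and
later a meeting would be a crossing, which `Clear` excludes. -/
theorem side_start_iff {i : ι} {j c : κ} (hir : i ≠ r) (hcl : A.Clear r i j) {p : ℝ}
    (hp : A.X i ≤ p) (hpj : p < A.Y j) (hpc : p < A.Y c) :
    A.F r c (A.X i) < A.hX i ↔ A.F r c p < A.F i j p := by
  have hs1 : Set.Icc (A.X i) p ⊆ Set.uIcc (A.X r) (A.Y c) := by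
    rw [Set.uIcc_of_le (hrY c).le]; exact Set.Icc_subset_Icc (hrX i) hpc.le
  have hs2 : Set.Icc (A.X i) p ⊆ Set.uIcc (A.X i) (A.Y j) := by
    rw [Set.uIcc_of_le (hp.trans hpj.le)]; exact Set.Icc_subset_Icc le_rfl hpj.le
  rw [← A.F_X i j]
  refine lt_iff_lt_of_ne_on_Icc hp ((A.cont r c).mono hs1) ((A.cont i j).mono hs2) ?_
  intro x hx h
  rcases hx.1.eq_or_lt with rfl | hlt
  · exact A.avoidX r c i hir (hs1 hx) (by rw [h, A.F_X])
  · refine hcl c ⟨by simp [hir], x, ?_, ?_, h.symm⟩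
    · rw [Set.uIoo_of_le (hp.trans hpj.le)]; exact ⟨hlt, hx.2.trans_lt hpj⟩
    · rw [Set.uIoo_of_le (hrY c).le]; exact ⟨(hrX i).trans_lt hlt, hx.2.trans_lt hpc⟩

/-- The counterpart of `side_start_iff` at the right end; here the star edge to `c ≠ j` avoids the
vertex `j`. -/
theorem side_end_iff {i : ι} {j c : κ} (hir : i ≠ r) (hcl : A.Clear r i j) {p : ℝ}
    (hp : A.X i < p) (hpj : p ≤ A.Y j) (hcj : c ≠ j) (hjc : A.Y j ≤ A.Y c) :
    A.F r c p < A.F i j p ↔ A.F r c (A.Y j) < A.hY j := by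
  have hs1 : Set.Icc p (A.Y j) ⊆ Set.uIcc (A.X r) (A.Y c) := by
    rw [Set.uIcc_of_le (hrY c).le]; exact Set.Icc_subset_Icc ((hrX i).trans hp.le) hjc
  have hs2 : Set.Icc p (A.Y j) ⊆ Set.uIcc (A.X i) (A.Y j) := by
    rw [Set.uIcc_of_le (hp.le.trans hpj)]; exact Set.Icc_subset_Icc hp.le le_rfl
  rw [← A.F_Y i j]
  refine lt_iff_lt_of_ne_on_Icc hpj ((A.cont r c).mono hs1) ((A.cont i j).mono hs2) ?_
  intro x hx h
  rcases hx.2.eq_or_lt with rfl | hlt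
  · exact A.avoidY r c j hcj.symm (hs1 hx) (by rw [h, A.F_Y])
  · refine hcl c ⟨by simp [hir], x, ?_, ?_, h.symm⟩
    · rw [Set.uIoo_of_le (hp.le.trans hpj)]; exact ⟨hp.trans_le hx.1, hlt⟩
    · rw [Set.uIoo_of_le (hrY c).le]
      exact ⟨(hrX i).trans_lt (hp.trans_le hx.1), hlt.trans_le hjc⟩

/-- At the crossing both edges have the same height, hence the same position relative to each star
edge. This position is carried forward along the first edge to `b` and backward along the second to
`w`. -/
theorem sameSide_of_cross {v w : ι} {b b' : κ} (hv : v ≠ r) (hw : w ≠ r) (hvb : A.X v < A.Y b)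
    (hwb : A.X w < A.Y b') (hcv : A.Clear r v b) (hcw : A.Clear r w b') (h : A.Cross v b w b') :
    A.X w < A.Y b ∧ A.SameSide r w b := by
  obtain ⟨hne, p, h1, h2, h3⟩ := h
  rw [Set.uIoo_of_le hvb.le] at h1
  rw [Set.uIoo_of_le hwb.le] at h2
  refine ⟨h2.1.trans h1.2, fun c hc hbc => ?_⟩
  rw [side_start_iff hrX hrY hw hcw h2.1.le h2.2 (h1.2.trans_le hbc), ← h3,
    side_end_iff hrX hrY hv hcv h1.1 h1.2.le hc hbc]

omit hrX in
/-- The edges at `r` have the same vertical order over all points to the right of `r`. -/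
theorem star_lt_iff {a b : κ} (hab : a ≠ b) {x y : ℝ} (hx : A.X r < x) (hxy : x ≤ y)
    (ha : y ≤ A.Y a) (hb : y ≤ A.Y b) : A.F r a x < A.F r b x ↔ A.F r a y < A.F r b y := by
  have hs : ∀ c, y ≤ A.Y c → Set.Icc x y ⊆ Set.uIcc (A.X r) (A.Y c) := fun c hc => by
    rw [Set.uIcc_of_le (hrY c).le]; exact Set.Icc_subset_Icc hx.le hc
  refine lt_iff_lt_of_ne_on_Icc hxy ((A.cont r a).mono (hs a ha)) ((A.cont r b).mono (hs b hb)) ?_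
  intro z hz h
  have := A.once r a r b (by simp [hab]) z (A.X r) (hs a ha hz) (hs b hb hz) (by simp) (by simp) h
    (by rw [A.F_X, A.F_X])
  exact (hx.trans_le hz.1).ne' this

-- Every star edge reaches the abscissa of the leftmost `j₀`, so the height there serves as a rank
-- that orders the whole star at once, even for edges of different lengths.
omit hrX in
theorem below_iff {j₀ a b : κ} (hj₀ : ∀ j, A.Y j₀ ≤ A.Y j) {x : ℝ} (hx : A.X r < x)
    (ha : x ≤ A.Y a) (hb : x ≤ A.Y b) :
    A.F r a (A.Y j₀) < A.F r b (A.Y j₀) ↔ A.F r a x < A.F r b x := by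
  rcases eq_or_ne a b with rfl | hab
  · simp
  rcases le_total x (A.Y j₀) with h | h
  · exact (star_lt_iff hrY hab hx h (hj₀ a) (hj₀ b)).symm
  · exact star_lt_iff hrY hab (hrY j₀) h ha hb

/-- Let `b` be the uppermost of the edges at `r` that pass below `i`, and let it end no later than
the edges at `r` that pass above `i`, up to passing to lower such edges. Then the edge from `i` to
`b` crosses no edge at `r`. -/
theorem clear_of_extremal {i : ι} (hir : i ≠ r) {j₀ b : κ} (hj₀ : ∀ j, A.Y j₀ ≤ A.Y j)
    (hib : A.X i < A.Y b) (hb : A.F r b (A.X i) < A.hX i)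
    (hmax : ∀ c, A.X i < A.Y c → A.F r c (A.X i) < A.hX i →
      A.F r c (A.Y j₀) ≤ A.F r b (A.Y j₀))
    (habove : ∀ c, A.X i < A.Y c → A.hX i < A.F r c (A.X i) → ∃ c', A.Y b ≤ A.Y c' ∧
      A.hX i < A.F r c' (A.X i) ∧ A.F r c' (A.Y j₀) ≤ A.F r c (A.Y j₀)) :
    A.Clear r i b := by
  rintro c ⟨-, x, h1, h2, h3⟩
  rw [Set.uIoo_of_le hib.le] at h1
  rw [Set.uIoo_of_le (hrY c).le] at h2
  have hcb : c ≠ b := by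
    rintro rfl
    refine not_cross_right (A := A) i r c ⟨by simp [hir], x, ?_, ?_, h3⟩
    · rwa [Set.uIoo_of_le hib.le]
    · rwa [Set.uIoo_of_le (hrY c).le]
  have hic : A.X i < A.Y c := h1.1.trans h2.2
  have hmem : ∀ d, A.X i < A.Y d → A.X i ∈ Set.uIcc (A.X r) (A.Y d) := fun d hd => by
    rw [Set.uIcc_of_le (hrY d).le]; exact ⟨hrX i, hd.le⟩
  -- over `(X i, Y b)` the edge to `b` stays above the star edge to `b`
  have hup : A.F r b x < A.F i b x := by
    have hs1 : Set.Icc (A.X i) x ⊆ Set.uIcc (A.X r) (A.Y b) := by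
      rw [Set.uIcc_of_le (hrY b).le]; exact Set.Icc_subset_Icc (hrX i) h1.2.le
    have hs2 : Set.Icc (A.X i) x ⊆ Set.uIcc (A.X i) (A.Y b) := by
      rw [Set.uIcc_of_le hib.le]; exact Set.Icc_subset_Icc le_rfl h1.2.le
    refine (lt_iff_lt_of_ne_on_Icc h1.1.le ((A.cont r b).mono hs1) ((A.cont i b).mono hs2) ?_).1
      (by rwa [A.F_X])
    intro z hz h
    have := A.once r b i b (by simp [hir.symm]) z (A.Y b) (hs1 hz) (hs2 hz) (by simp) (by simp) h
      (by rw [A.F_Y, A.F_Y])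
    exact (hz.2.trans_lt h1.2).ne this
  -- A star edge `c` passing below `i` is ranked no higher than `b`, while the edge from `i` runs
  -- strictly above `b`. A star edge passing above `i` is separated from it by `d`.
  rcases lt_or_gt_of_ne (A.avoidX r c i hir (hmem c hic)) with hc | hc
  · have hle := hmax c hic hc
    have : ¬ A.F r b x < A.F r c x := by
      rw [← below_iff hrY hj₀ h2.1 h1.2.le h2.2.le]; exact not_lt.2 hle
    rw [h3] at hup
    exact this hup
  · obtain ⟨d, hbd, hid, hdc⟩ := habove c hic hc
    have hXd : A.X i < A.Y d := hib.trans_le hbd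
    -- All star edges have the same height over `X r`, so over that abscissa one could not be below
    -- `i` and another above it.
    have hri : A.X r < A.X i := by
      refine lt_of_le_of_ne (hrX i) fun h => ?_
      rw [← h, A.F_X] at hb hid
      exact lt_asymm hb hid
    have hbd' : A.F r b (A.Y b) < A.F r d (A.Y b) := by
      rw [← below_iff hrY hj₀ (hrY b) le_rfl hbd,
        below_iff hrY hj₀ hri hib.le hXd.le]
      exact hb.trans hid
    have hs1 : Set.Icc (A.X i) (A.Y b) ⊆ Set.uIcc (A.X i) (A.Y b) := by
      rw [Set.uIcc_of_le hib.le]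
    have hs2 : Set.Icc (A.X i) (A.Y b) ⊆ Set.uIcc (A.X r) (A.Y d) := by
      rw [Set.uIcc_of_le (hrY d).le]; exact Set.Icc_subset_Icc (hrX i) hbd
    -- At its right end the edge from `i` lies on the star edge to `b`, which is ranked below `d`.
    -- It is thus below `d` at both ends, and therefore throughout.
    have hlt : A.F i b x < A.F r d x :=
      lt_of_lt_ends (by simp [hir]) hs1 hs2 (by rwa [A.F_X]) (by rwa [A.F_Y, ← A.F_Y r b])
        ⟨h1.1.le, h1.2.le⟩
    have : ¬ A.F r c x < A.F r d x := by
      rw [← below_iff hrY hj₀ h2.1 h2.2.le (h1.2.le.trans hbd)]; exact not_lt.2 hdc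
    rw [h3] at hlt
    exact this hlt

omit hrX in
/-- If `b` is on the same side as `i` of the star edges that reach it, then it ends no earlier than
the uppermost star edge below `i`, unless it passes above `i`. -/
theorem le_of_sameSide {i : ι} {j₀ b d : κ} (hj₀ : ∀ j, A.Y j₀ ≤ A.Y j)
    (hss : A.SameSide r i b) (hd : A.F r d (A.X i) < A.hX i)
    (hmax : A.F r b (A.Y j₀) ≤ A.F r d (A.Y j₀)) (hbd : b ≠ d) : A.Y d < A.Y b := by
  by_contra hc
  have hle := not_lt.1 hc
  have h := (hss d hbd.symm hle).1 hd
  -- The vertex `b` is the end of its own star edge, so `d` lying below the vertex means that `d` is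
  -- ranked below `b`.
  rw [← A.F_Y r b, ← below_iff hrY hj₀ (hrY b) hle le_rfl] at h
  exact absurd h (not_lt.2 hmax)

-- Reflection reverses the strict inequalities. The equivalence survives because the star edges
-- concerned pass through neither `i` nor `b`, so equality never occurs.
omit hrY in
theorem SameSide.neg {i : ι} {b : κ} (hir : i ≠ r) (hib : A.X i < A.Y b)
    (h : A.SameSide r i b) : A.neg.SameSide r i b := by
  intro c hc (hbc : A.Y b ≤ A.Y c)
  have h' := h c hc hbc
  have e1 : A.F r c (A.X i) ≠ A.hX i := A.avoidX r c i hir <| by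
    rw [Set.uIcc_of_le ((hrX i).trans (hib.le.trans hbc))]; exact ⟨hrX i, hib.le.trans hbc⟩
  have e2 : A.F r c (A.Y b) ≠ A.hY b := A.avoidY r c b hc.symm <| by
    rw [Set.uIcc_of_le ((hrX i).trans (hib.le.trans hbc))]; exact ⟨(hrX i).trans hib.le, hbc⟩
  have h1 : A.hX i < A.F r c (A.X i) ↔ ¬ A.F r c (A.X i) < A.hX i :=
    ⟨fun h => h.not_gt, fun h => lt_of_le_of_ne (not_lt.1 h) e1.symm⟩
  have h2 : A.hY b < A.F r c (A.Y b) ↔ ¬ A.F r c (A.Y b) < A.hY b :=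
    ⟨fun h => h.not_gt, fun h => lt_of_le_of_ne (not_lt.1 h) e2.symm⟩
  simp only [MonoFamily.neg, neg_lt_neg_iff]
  rw [h1, h2, h']

/-- This is the case in which the star edge just below `i` ends first; the other case is its mirror
image under `neg`. For the bound, a competitor `b'` whose star edge passes below `i` is compared
with `b`. If it passes above `i`, it is compared, after reflection, with the lowest upper edge `d`,
which ends no earlier than `b`. -/
theorem clear_and_le_of_extremal {pos : κ → ℕ} (hinj : Function.Injective pos)
    (hpos : ∀ a b, pos a < pos b → A.Y a ≤ A.Y b) {i : ι} (hir : i ≠ r) {j₀ b : κ}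
    (hj₀ : ∀ j, A.Y j₀ ≤ A.Y j) (hib : A.X i < A.Y b) (hb : A.F r b (A.X i) < A.hX i)
    (hmax : ∀ c, A.X i < A.Y c → A.F r c (A.X i) < A.hX i →
      A.F r c (A.Y j₀) ≤ A.F r b (A.Y j₀))
    (habove : ∀ c, A.X i < A.Y c → A.hX i < A.F r c (A.X i) → ∃ d, pos b ≤ pos d ∧
      A.hX i < A.F r d (A.X i) ∧ ∀ c', A.X i < A.Y c' → A.hX i < A.F r c' (A.X i) →
        A.F r d (A.Y j₀) ≤ A.F r c' (A.Y j₀)) :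
    A.Clear r i b ∧ ∀ b', A.X i < A.Y b' → A.SameSide r i b' → pos b ≤ pos b' := by
  have hle : ∀ a b, pos a ≤ pos b → A.Y a ≤ A.Y b := fun a b h => by
    rcases h.eq_or_lt with h | h
    · rw [hinj h]
    · exact hpos a b h
  have hlt : ∀ a b, A.Y a < A.Y b → pos a < pos b := fun a b h => by
    by_contra hc
    exact absurd h (not_lt.2 (hle b a (not_lt.1 hc)))
  constructor
  · refine clear_of_extremal hrX hrY hir hj₀ hib hb hmax fun c hc hc' => ?_
    obtain ⟨d, h1, h2, h3⟩ := habove c hc hc'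
    exact ⟨d, hle _ _ h1, h2, h3 c hc hc'⟩
  · intro b' hib' hss
    have hmem : A.X i ∈ Set.uIcc (A.X r) (A.Y b') := by
      rw [Set.uIcc_of_le (hrY b').le]; exact ⟨hrX i, hib'.le⟩
    rcases lt_or_gt_of_ne (A.avoidX r b' i hir hmem) with hc | hc
    · rcases eq_or_ne b' b with rfl | hne
      · exact le_rfl
      · exact (hlt _ _ (le_of_sameSide hrY hj₀ hss hb (hmax b' hib' hc) hne)).le
    · obtain ⟨d, h1, h2, h3⟩ := habove b' hib' hc
      rcases eq_or_ne b' d with rfl | hne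
      · exact h1
      · refine h1.trans (hlt _ _ ?_).le
        exact le_of_sameSide (A := A.neg) hrY hj₀ (hss.neg hrX hir hib') (d := d)
          (neg_lt_neg h2) (neg_le_neg (h3 b' hib' hc)) hne

/-- If some vertex of the other class lies to the right of `i`, then some edge from `i` to the right
crosses no edge at `r`. It can be chosen to end before every other vertex that lies on the same side
as `i` of the edges at `r`. -/
theorem exists_clear [Finite κ] {pos : κ → ℕ} (hinj : Function.Injective pos)
    (hpos : ∀ a b, pos a < pos b → A.Y a ≤ A.Y b) {i : ι} (hir : i ≠ r)
    (hex : ∃ j, A.X i < A.Y j) :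
    ∃ b, A.X i < A.Y b ∧ A.Clear r i b ∧
      ∀ b', A.X i < A.Y b' → A.SameSide r i b' → pos b ≤ pos b' := by
  obtain ⟨j₁, hj₁⟩ := hex
  have : Nonempty κ := ⟨j₁⟩
  obtain ⟨j₀, hj₀⟩ := Finite.exists_min A.Y
  -- Every star edge reaching beyond `i` passes strictly below or strictly above `i`; the top of
  -- `dn` and the bottom of `up` enclose `i`.
  let dn : Set κ := {c | A.X i < A.Y c ∧ A.F r c (A.X i) < A.hX i}
  let up : Set κ := {c | A.X i < A.Y c ∧ A.hX i < A.F r c (A.X i)}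
  have hdn : dn.Nonempty → ∃ b ∈ dn, ∀ c ∈ dn, A.F r c (A.Y j₀) ≤ A.F r b (A.Y j₀) := fun h =>
    Set.exists_max_image dn _ (Set.toFinite _) h
  have hup : up.Nonempty → ∃ b ∈ up, ∀ c ∈ up, A.F r b (A.Y j₀) ≤ A.F r c (A.Y j₀) := fun h =>
    Set.exists_min_image up _ (Set.toFinite _) h
  have low : ∀ b ∈ dn, (∀ c ∈ dn, A.F r c (A.Y j₀) ≤ A.F r b (A.Y j₀)) →
      (up.Nonempty → ∃ d ∈ up, (∀ c ∈ up, A.F r d (A.Y j₀) ≤ A.F r c (A.Y j₀)) ∧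
        pos b ≤ pos d) →
      ∃ b, A.X i < A.Y b ∧ A.Clear r i b ∧
        ∀ b', A.X i < A.Y b' → A.SameSide r i b' → pos b ≤ pos b' := by
    intro b hb hmax h
    refine ⟨b, hb.1, clear_and_le_of_extremal hrX hrY hinj hpos hir hj₀ hb.1 hb.2
      (fun c h1 h2 => hmax c ⟨h1, h2⟩) fun c h1 h2 => ?_⟩
    obtain ⟨d, hd, h3, h4⟩ := h ⟨c, h1, h2⟩
    exact ⟨d, h4, hd.2, fun c' h5 h6 => h3 c' ⟨h5, h6⟩⟩
  have high : ∀ b ∈ up, (∀ c ∈ up, A.F r b (A.Y j₀) ≤ A.F r c (A.Y j₀)) →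
      (dn.Nonempty → ∃ d ∈ dn, (∀ c ∈ dn, A.F r c (A.Y j₀) ≤ A.F r d (A.Y j₀)) ∧
        pos b ≤ pos d) →
      ∃ b, A.X i < A.Y b ∧ A.Clear r i b ∧
        ∀ b', A.X i < A.Y b' → A.SameSide r i b' → pos b ≤ pos b' := by
    intro b hb hmin h
    have := clear_and_le_of_extremal (A := A.neg) hrX hrY hinj hpos hir hj₀ hb.1
      (neg_lt_neg hb.2)
      (fun c h1 h2 => neg_le_neg (hmin c ⟨h1, neg_lt_neg_iff.1 h2⟩)) fun c h1 h2 => ?_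
    · exact ⟨b, hb.1, fun j' hj' => this.1 j' (A.neg_cross.2 hj'),
        fun b' h1 h2 => this.2 b' h1 (h2.neg hrX hir h1)⟩
    · obtain ⟨d, hd, h3, h4⟩ := h ⟨c, h1, neg_lt_neg_iff.1 h2⟩
      exact ⟨d, h4, neg_lt_neg hd.2, fun c' h5 h6 => neg_le_neg (h3 c' ⟨h5, neg_lt_neg_iff.1 h6⟩)⟩
  by_cases hd : dn.Nonempty
  · obtain ⟨b, hb, hbm⟩ := hdn hd
    by_cases hu : up.Nonempty
    · obtain ⟨d, hd', hdm⟩ := hup hu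
      -- The target must be the one that ends first, so that the other still bounds the new edge
      -- over its whole length.
      rcases le_total (pos b) (pos d) with h | h
      · exact low b hb hbm fun _ => ⟨d, hd', hdm, h⟩
      · exact high d hd' hdm fun _ => ⟨b, hb, hbm, h⟩
    · exact low b hb hbm fun h => absurd h hu
  · have hu : up.Nonempty := by
      have hmem : A.X i ∈ Set.uIcc (A.X r) (A.Y j₁) := by
        rw [Set.uIcc_of_le (hrY j₁).le]; exact ⟨hrX i, hj₁.le⟩
      rcases lt_or_gt_of_ne (A.avoidX r j₁ i hir hmem) with hc | hc
      · exact absurd ⟨j₁, hj₁, hc⟩ hd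
      · exact ⟨j₁, hj₁, hc⟩
    obtain ⟨d, hd', hdm⟩ := hup hu
    exact high d hd' hdm fun h => absurd h hd

/-- Joining every `i ≠ r` to the first possible vertex on its right by an edge that crosses no edge
at `r`, or to the last vertex if there is none, gives a plane set of edges. -/
theorem plane_of_choice [Finite κ] {pos : κ → ℕ} (hinj : Function.Injective pos)
    (hpos : ∀ a b, pos a < pos b → A.Y a ≤ A.Y b) {c : ι → κ}
    (hc : ∀ i ≠ r, (∃ j, A.X i < A.Y j ∧ A.Clear r i j) →
      A.X i < A.Y (c i) ∧ A.Clear r i (c i) ∧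
        ∀ j, A.X i < A.Y j → A.Clear r i j → pos (c i) ≤ pos j)
    (hc' : ∀ i ≠ r, (¬ ∃ j, A.X i < A.Y j ∧ A.Clear r i j) → ∀ j, pos j ≤ pos (c i)) :
    (∀ i ≠ r, A.Clear r i (c i)) ∧
      ∀ i ≠ r, ∀ i' ≠ r, ¬ A.Cross i (c i) i' (c i') := by
  have hle : ∀ a b, pos a ≤ pos b → A.Y a ≤ A.Y b := fun a b h => by
    rcases h.eq_or_lt with h | h
    · rw [hinj h]
    · exact hpos a b h
  -- a vertex without an admissible edge to the right lies to the right of the whole other class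
  have hlast : ∀ i ≠ r, (¬ ∃ j, A.X i < A.Y j ∧ A.Clear r i j) →
      A.Y (c i) < A.X i ∧ ∀ j, A.Y j ≤ A.Y (c i) := by
    intro i hi hn
    refine ⟨lt_of_le_of_ne (not_lt.1 fun h => ?_) (A.ne i _).symm, fun j => hle _ _ (hc' i hi hn j)⟩
    obtain ⟨b, h1, h2, -⟩ := exists_clear hrX hrY hinj hpos hi ⟨c i, h⟩
    exact hn ⟨b, h1, h2⟩
  -- A default edge lies over abscissas beyond the last vertex of the other class, whereas an edge
  -- leading to the right ends at or before that vertex; the interiors of their spans are disjoint.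
  have hleft : ∀ i ≠ r, (¬ ∃ j, A.X i < A.Y j ∧ A.Clear r i j) → ∀ i' j', A.X i' < A.Y j' →
      ¬ A.Cross i (c i) i' j' := by
    rintro i hi hn i' j' hi' ⟨-, x, h1, h2, -⟩
    obtain ⟨h3, h4⟩ := hlast i hi hn
    rw [Set.uIoo_of_ge h3.le] at h1
    rw [Set.uIoo_of_le hi'.le] at h2
    exact absurd (h1.1.trans h2.2) (not_lt.2 (h4 j'))
  constructor
  · intro i hi
    by_cases h : ∃ j, A.X i < A.Y j ∧ A.Clear r i j
    · exact (hc i hi h).2.1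
    · exact fun j' => hleft i hi h r j' (hrY j')
  · intro i hi i' hi' hcr
    by_cases h : ∃ j, A.X i < A.Y j ∧ A.Clear r i j
    swap
    · by_cases h' : ∃ j, A.X i' < A.Y j ∧ A.Clear r i' j
      · exact hleft i hi h _ _ (hc i' hi' h').1 hcr
      · have : c i = c i' := hinj (le_antisymm (hc' i' hi' h' _) (hc' i hi h _))
        rw [this] at hcr
        exact not_cross_right _ _ _ hcr
    by_cases h' : ∃ j, A.X i' < A.Y j ∧ A.Clear r i' j
    swap
    · exact hleft i' hi' h' _ _ (hc i hi h).1 hcr.symm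
    -- Exchange argument: a crossing would give `w` a clear neighbour no later than `c v`, hence
    -- earlier than its first clear neighbour `c w`.
    have key : ∀ v ≠ r, ∀ w ≠ r, (∃ j, A.X v < A.Y j ∧ A.Clear r v j) →
        (∃ j, A.X w < A.Y j ∧ A.Clear r w j) → pos (c v) < pos (c w) →
        ¬ A.Cross v (c v) w (c w) := by
      intro v hv w hw h1 h2 hlt hcr
      obtain ⟨a1, a2, -⟩ := hc v hv h1
      obtain ⟨b1, b2, b3⟩ := hc w hw h2
      obtain ⟨e1, e2⟩ := sameSide_of_cross hrX hrY hv hw a1 b1 a2 b2 hcr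
      obtain ⟨β, f1, f2, f3⟩ := exists_clear hrX hrY hinj hpos hw ⟨c v, e1⟩
      exact absurd hlt (not_lt.2 ((b3 β f1 f2).trans (f3 _ e1 e2)))
    rcases lt_trichotomy (pos (c i)) (pos (c i')) with hlt | heq | hlt
    · exact key i hi i' hi' h h' hlt hcr
    · rw [hinj heq] at hcr
      exact not_cross_right _ _ _ hcr
    · exact key i' hi' i hi h' h hlt hcr.symm

end Star

end MonoFamily

/-! ### Touching is not a proper crossing -/

/-- Two graphs of functions that cross properly do not merely touch. -/
theorem not_isProperCrossing_of_lt {S T : Set (ℝ × ℝ)} {f g : ℝ → ℝ} {x₀ δ : ℝ} (hδ : 0 < δ)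
    (hg : ContinuousOn g (Set.Ioo (x₀ - δ) (x₀ + δ)))
    (hS : ∀ q : ℝ × ℝ, q.1 ∈ Set.Ioo (x₀ - δ) (x₀ + δ) → (q ∈ S ↔ q.2 = f q.1))
    (hT : ∀ q : ℝ × ℝ, q.1 ∈ Set.Ioo (x₀ - δ) (x₀ + δ) → (q ∈ T ↔ q.2 = g q.1))
    (hlt : ∀ x ∈ Set.Ioo (x₀ - δ) (x₀ + δ), x ≠ x₀ → f x < g x) :
    ¬ IsProperCrossing S T (x₀, g x₀) := by
  rintro ⟨hpS, hpT, φ, hp, hφ⟩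
  have hx₀ : x₀ ∈ Set.Ioo (x₀ - δ) (x₀ + δ) := ⟨by linarith, by linarith⟩
  have hfg : g x₀ = f x₀ := (hS _ hx₀).1 hpS
  set p : ℝ × ℝ := (x₀, g x₀) with hpdef
  have hφp : φ p = 0 := Prod.ext ((hφ p hp).2.1 hpT) ((hφ p hp).1.1 hpS)
  obtain ⟨ε, hε, hball⟩ := Metric.isOpen_iff.1 φ.open_source p hp
  obtain ⟨η, hη, hgη⟩ : ∃ η > 0, ∀ x, |x - x₀| < η → |g x - g x₀| < ε / 2 := by
    have := (hg.continuousAt (Ioo_mem_nhds hx₀.1 hx₀.2))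
    obtain ⟨η, h1, h2⟩ := Metric.continuousAt_iff.1 this (ε / 2) (half_pos hε)
    exact ⟨η, h1, fun x hx => h2 hx⟩
  let ρ := min η (min δ ε)
  have hρ : 0 < ρ := lt_min hη (lt_min hδ hε)
  have hbox : ∀ q : ℝ × ℝ, |q.1 - x₀| < ρ → |q.2 - g x₀| < ε → q ∈ φ.source := fun q h1 h2 => by
    refine hball ?_
    rw [Metric.mem_ball, Prod.dist_eq]
    exact max_lt (h1.trans_le ((min_le_right _ _).trans (min_le_right _ _))) h2
  have hIoo : ∀ x, |x - x₀| < ρ → x ∈ Set.Ioo (x₀ - δ) (x₀ + δ) := fun x h => by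
    have h' := abs_lt.1 (h.trans_le ((min_le_right _ _).trans (min_le_left _ _)))
    exact ⟨by linarith [h'.1], by linarith [h'.2]⟩
  have hgρ : ∀ x, |x - x₀| < ρ → |g x - g x₀| < ε / 2 := fun x h =>
    hgη x (h.trans_le (min_le_left _ _))
  -- the second coordinate of `φ` has constant sign on connected sets above the graph of `f`
  have hsign : ∀ K : Set (ℝ × ℝ), IsPreconnected K → K ⊆ φ.source → (∀ q ∈ K, q ∉ S) →
      ∀ a ∈ K, ∀ b ∈ K, 0 < (φ a).2 → 0 < (φ b).2 := by
    intro K hK hsub hav a ha b hb hpos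
    by_contra hneg
    have hcont : ContinuousOn (fun q => (φ q).2) K :=
      continuous_snd.comp_continuousOn (φ.continuousOn.mono hsub)
    obtain ⟨q, hq, hq0⟩ := hK.intermediate_value hb ha hcont
      (show (0 : ℝ) ∈ Set.Icc _ _ from ⟨not_lt.1 hneg, hpos.le⟩)
    exact hav q hq ((hφ q (hsub hq)).1.2 hq0)
  -- `M` exceeds `g` over the whole `ρ`-interval. Every point of the graph of `g` other than `p` is
  -- joined to `(x₀, M)` by a vertical and then a horizontal segment that avoid the graph of `f`, so
  -- the sign of the second chart coordinate is the same at all of them.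
  set M := g x₀ + ε / 2 with hM
  have hvert : ∀ x, |x - x₀| < ρ → x ≠ x₀ → (0 < (φ (x, g x)).2 ↔ 0 < (φ (x, M)).2) := by
    intro x hx hne
    have hgx := abs_lt.1 (hgρ x hx)
    have hK : IsPreconnected ((fun y : ℝ => (x, y)) '' Set.Icc (g x) M) :=
      isPreconnected_Icc.image _ (by fun_prop)
    have hsub : (fun y : ℝ => (x, y)) '' Set.Icc (g x) M ⊆ φ.source := by
      rintro _ ⟨y, hy, rfl⟩
      refine hbox _ hx (abs_lt.2 ⟨?_, ?_⟩) <;> simp only <;> linarith [hy.1, hy.2, hgx.1]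
    have hav : ∀ q ∈ (fun y : ℝ => (x, y)) '' Set.Icc (g x) M, q ∉ S := by
      rintro _ ⟨y, hy, rfl⟩ hq
      have := (hS _ (hIoo x hx)).1 hq
      have h2 := hlt x (hIoo x hx) hne
      simp only at this
      linarith [hy.1]
    have m1 : (x, g x) ∈ (fun y : ℝ => (x, y)) '' Set.Icc (g x) M :=
      ⟨_, ⟨le_rfl, by linarith [hgx.2]⟩, rfl⟩
    have m2 : (x, M) ∈ (fun y : ℝ => (x, y)) '' Set.Icc (g x) M :=
      ⟨_, ⟨by linarith [hgx.2], le_rfl⟩, rfl⟩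
    exact ⟨hsign _ hK hsub hav _ m1 _ m2, hsign _ hK hsub hav _ m2 _ m1⟩
  have hhor : ∀ x, |x - x₀| < ρ → (0 < (φ (x, M)).2 ↔ 0 < (φ (x₀, M)).2) := by
    intro x hx
    have hK : IsPreconnected ((fun x : ℝ => (x, M)) '' Metric.ball x₀ ρ) :=
      (convex_ball x₀ ρ).isPreconnected.image _ (by fun_prop)
    have hsub : (fun x : ℝ => (x, M)) '' Metric.ball x₀ ρ ⊆ φ.source := by
      rintro _ ⟨y, hy, rfl⟩
      refine hbox _ (by simpa [Real.dist_eq] using hy) ?_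
      simp only [hM, add_sub_cancel_left]
      rw [abs_of_pos (half_pos hε)]
      exact half_lt_self hε
    have hav : ∀ q ∈ (fun x : ℝ => (x, M)) '' Metric.ball x₀ ρ, q ∉ S := by
      rintro _ ⟨y, hy, rfl⟩ hq
      have hy' : |y - x₀| < ρ := by simpa [Real.dist_eq] using hy
      have h1 := (hS _ (hIoo y hy')).1 hq
      have h2 := (abs_lt.1 (hgρ y hy')).2
      have h3 : f y ≤ g y := by
        rcases eq_or_ne y x₀ with rfl | hne
        · exact hfg.ge
        · exact (hlt y (hIoo y hy') hne).le
      simp only at h1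
      linarith
    have m1 : (x, M) ∈ (fun x : ℝ => (x, M)) '' Metric.ball x₀ ρ :=
      ⟨x, by simpa [Real.dist_eq] using hx, rfl⟩
    have m2 : (x₀, M) ∈ (fun x : ℝ => (x, M)) '' Metric.ball x₀ ρ := ⟨x₀, by simpa using hρ, rfl⟩
    exact ⟨hsign _ hK hsub hav _ m1 _ m2, hsign _ hK hsub hav _ m2 _ m1⟩
  have h0 : (0 : ℝ × ℝ) ∈ φ.target := hφp ▸ φ.map_source hp
  have hsymm0 : φ.symm 0 = p := by rw [← hφp, φ.left_inv hp]
  obtain ⟨τ, hτ, hτb⟩ := Metric.isOpen_iff.1 φ.open_target 0 h0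
  obtain ⟨τ', hτ', hτb'⟩ := Metric.continuousAt_iff.1 (φ.symm.continuousAt h0) ρ hρ
  -- Small points `(0, y)` of the chart's vertical axis come from points of `T` near `p`. By the
  -- constant sign, `y` would have the same sign for all of them, which fails for a pair `±y`.
  have hpt : ∀ y, y ≠ 0 → |y| < min τ τ' → (0 < y ↔ 0 < (φ (x₀, M)).2) := by
    intro y hy hyτ
    have hd : dist ((0 : ℝ), y) 0 = |y| := by simp
    have ht : ((0 : ℝ), y) ∈ φ.target :=
      hτb (by rw [Metric.mem_ball, hd]; exact hyτ.trans_le (min_le_left _ _))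
    have hq := hτb' (x := ((0 : ℝ), y)) (by rw [hd]; exact hyτ.trans_le (min_le_right _ _))
    have hφq := φ.right_inv ht
    have hqs := φ.map_target ht
    change dist (φ.symm (0, y)) (φ.symm 0) < ρ at hq
    rw [hsymm0, Prod.dist_eq] at hq
    change φ.symm (0, y) ∈ φ.source at hqs
    change φ (φ.symm (0, y)) = (0, y) at hφq
    generalize φ.symm (0, y) = q at hq hφq hqs
    have hq1 : |q.1 - x₀| < ρ := (le_max_left _ _).trans_lt hq
    have hqT : q ∈ T := (hφ q hqs).2.2 (by rw [hφq])
    have hq2 := (hT q (hIoo _ hq1)).1 hqT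
    have hqe : q = (q.1, g q.1) := Prod.ext rfl hq2
    have hne : q.1 ≠ x₀ := fun h => by
      rw [h] at hqe
      rw [hqe, hφp] at hφq
      exact hy (congrArg Prod.snd hφq).symm
    rw [← hhor _ hq1, ← hvert _ hq1 hne, ← hqe, hφq]
  have hpos : 0 < min τ τ' := lt_min hτ hτ'
  have h1 := hpt (min τ τ' / 2) (half_pos hpos).ne'
    (by rw [abs_of_pos (half_pos hpos)]; exact half_lt_self hpos)
  have h2 := hpt (-(min τ τ' / 2)) (neg_ne_zero.2 (half_pos hpos).ne')
    (by rw [abs_neg, abs_of_pos (half_pos hpos)]; exact half_lt_self hpos)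
  have := h2.2 (h1.1 (half_pos hpos))
  linarith

/-! ### From simple monotone drawings to height functions -/

namespace BDrawing

variable {m n : ℕ} {D : BDrawing m n}

/-- The `x`-coordinates of the two endpoints of an edge span this interval. -/
def span (D : BDrawing m n) (e : BEdge m n) : Set ℝ :=
  Set.uIcc (D.pt (Sum.inl e.1)).1 (D.pt (Sum.inr e.2)).1

/-- The interior of the interval that is spanned by the endpoints of an edge. -/
def innerSpan (D : BDrawing m n) (e : BEdge m n) : Set ℝ :=
  Set.uIoo (D.pt (Sum.inl e.1)).1 (D.pt (Sum.inr e.2)).1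

/-- The height of the edge `e` over the abscissa `x`. -/
noncomputable def height (D : BDrawing m n) (e : BEdge m n) (x : ℝ) : ℝ :=
  -- If `x` is not an abscissa of the edge, `invFun` yields an arbitrary parameter; the value is
  -- meaningful only over `span`.
  (D.curve e (Function.invFun (fun t => (D.curve e t).1) x)).2

variable (hs : D.IsSimple) (hm : D.IsXMonotone)
include hs hm

theorem abscissa_injective (e : BEdge m n) : Function.Injective fun t => (D.curve e t).1 :=
  fun s t h => hs.curve_injective e (hm e s t h)

theorem height_abscissa (e : BEdge m n) (t : I) : D.height e (D.curve e t).1 = (D.curve e t).2 := by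
  rw [height]
  congr 2
  exact Function.leftInverse_invFun (abscissa_injective hs hm e) t

omit hs hm in
theorem continuous_abscissa (e : BEdge m n) : Continuous fun t => (D.curve e t).1 :=
  continuous_fst.comp (D.curve e).continuous

theorem abscissa_mono (e : BEdge m n) :
    StrictMono (fun t => (D.curve e t).1) ∨ StrictAnti (fun t => (D.curve e t).1) :=
  (continuous_abscissa e).strictMono_of_inj (abscissa_injective hs hm e)

theorem abscissa_mem_innerSpan_iff (e : BEdge m n) (t : I) :
    (D.curve e t).1 ∈ D.innerSpan e ↔ t ∈ Set.Ioo (0 : I) 1 := by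
  have h0 : (D.curve e 0).1 = (D.pt (Sum.inl e.1)).1 := by rw [(D.curve e).source]
  have h1 : (D.curve e 1).1 = (D.pt (Sum.inr e.2)).1 := by rw [(D.curve e).target]
  rw [innerSpan, ← h0, ← h1]
  rcases abscissa_mono hs hm e with h | h
  · rw [Set.uIoo_of_le (h.monotone zero_le_one)]
    exact and_congr h.lt_iff_lt h.lt_iff_lt
  · rw [Set.uIoo_of_ge (h.antitone zero_le_one)]
    exact and_comm.trans (and_congr h.lt_iff_gt h.lt_iff_gt)

omit hs hm in
theorem exists_abscissa_eq (e : BEdge m n) {x : ℝ} (hx : x ∈ D.span e) :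
    ∃ t, (D.curve e t).1 = x := by
  have h0 : (D.curve e 0).1 = (D.pt (Sum.inl e.1)).1 := by rw [(D.curve e).source]
  have h1 : (D.curve e 1).1 = (D.pt (Sum.inr e.2)).1 := by rw [(D.curve e).target]
  rw [span, ← h0, ← h1] at hx
  have := (isPreconnected_univ (α := I)).image _ (continuous_abscissa (D := D) e).continuousOn
  obtain ⟨t, -, ht⟩ := this.ordConnected.uIcc_subset ⟨0, trivial, rfl⟩ ⟨1, trivial, rfl⟩ hx
  exact ⟨t, ht⟩

theorem exists_curve_eq (e : BEdge m n) {x : ℝ} (hx : x ∈ D.span e) :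
    ∃ t, D.curve e t = (x, D.height e x) := by
  obtain ⟨t, rfl⟩ := exists_abscissa_eq e hx
  exact ⟨t, Prod.ext rfl (height_abscissa hs hm e t).symm⟩

theorem exists_curve_eq_of_mem_innerSpan (e : BEdge m n) {x : ℝ} (hx : x ∈ D.innerSpan e) :
    ∃ t ∈ Set.Ioo (0 : I) 1, D.curve e t = (x, D.height e x) := by
  obtain ⟨t, ht⟩ := exists_curve_eq hs hm e (x := x) ⟨hx.1.le, hx.2.le⟩
  exact ⟨t, (abscissa_mem_innerSpan_iff hs hm e t).1 (by rwa [ht]), ht⟩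

theorem mem_range_curve_iff (e : BEdge m n) {q : ℝ × ℝ} (hq : q.1 ∈ D.span e) :
    q ∈ Set.range (D.curve e) ↔ q.2 = D.height e q.1 := by
  constructor
  · rintro ⟨t, rfl⟩
    exact (height_abscissa hs hm e t).symm
  · intro h
    obtain ⟨t, ht⟩ := exists_curve_eq hs hm e hq
    exact ⟨t, ht.trans (Prod.ext rfl h.symm)⟩

/-- An injective continuous map on a compact interval is an embedding, so the parameter depends
continuously on the abscissa. -/
theorem continuousOn_height (e : BEdge m n) : ContinuousOn (D.height e) (D.span e) := by
  have hemb := ((continuous_abscissa (D := D) e).isClosedEmbedding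
    (abscissa_injective hs hm e)).isEmbedding
  have hsub : D.span e ⊆ Set.range fun t => (D.curve e t).1 := fun x hx =>
    exists_abscissa_eq e hx
  refine ContinuousOn.mono ?_ hsub
  rw [continuousOn_iff_continuous_domRestrict]
  have : (Set.range fun t => (D.curve e t).1).domRestrict (D.height e) =
      fun x => (D.curve e (hemb.toHomeomorph.symm x)).2 := by
    funext x
    obtain ⟨t, rfl⟩ := hemb.toHomeomorph.surjective x
    rw [Homeomorph.symm_apply_apply]
    exact height_abscissa hs hm e t
  rw [this]
  exact continuous_snd.comp ((D.curve e).continuous.comp hemb.toHomeomorph.symm.continuous)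

theorem height_source (e : BEdge m n) :
    D.height e (D.pt (Sum.inl e.1)).1 = (D.pt (Sum.inl e.1)).2 := by
  have := height_abscissa hs hm e 0
  rwa [(D.curve e).source] at this

theorem height_target (e : BEdge m n) :
    D.height e (D.pt (Sum.inr e.2)).1 = (D.pt (Sum.inr e.2)).2 := by
  have := height_abscissa hs hm e 1
  rwa [(D.curve e).target] at this

/-- Adjacent vertices have different abscissas, so ties in the sorted order are confined to one
class. -/
theorem abscissa_ne (e : BEdge m n) : (D.pt (Sum.inl e.1)).1 ≠ (D.pt (Sum.inr e.2)).1 := by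
  intro h
  have := abscissa_injective hs hm e (a₁ := 0) (a₂ := 1)
    (by simpa only [(D.curve e).source, (D.curve e).target] using h)
  exact zero_ne_one this

theorem height_ne_of_not_incident (e : BEdge m n) {v : BVertex m n} (hv : ¬ BIncident e v)
    (hx : (D.pt v).1 ∈ D.span e) : D.height e (D.pt v).1 ≠ (D.pt v).2 := by
  intro h
  obtain ⟨t, ht⟩ := exists_curve_eq hs hm e hx
  exact hv (hs.avoids_vertices e t v (ht.trans (Prod.ext rfl h)))

theorem height_meet_once {e f : BEdge m n} (hef : e ≠ f) {x y : ℝ} (h1 : x ∈ D.span e)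
    (h2 : x ∈ D.span f) (h3 : y ∈ D.span e) (h4 : y ∈ D.span f)
    (h5 : D.height e x = D.height f x) (h6 : D.height e y = D.height f y) : x = y := by
  obtain ⟨s, hs1⟩ := exists_curve_eq hs hm e h1
  obtain ⟨t, ht1⟩ := exists_curve_eq hs hm f h2
  obtain ⟨s', hs2⟩ := exists_curve_eq hs hm e h3
  obtain ⟨t', ht2⟩ := exists_curve_eq hs hm f h4
  have := hs.meet_once e f hef s t s' t' (by rw [hs1, ht1, h5]) (by rw [hs2, ht2, h6])
  rw [hs1, hs2] at this
  exact congrArg Prod.fst this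

theorem crosses_iff {e f : BEdge m n} : D.Crosses e f ↔ e ≠ f ∧
    ∃ x, x ∈ D.innerSpan e ∧ x ∈ D.innerSpan f ∧ D.height e x = D.height f x := by
  refine and_congr_right fun hef => ⟨?_, ?_⟩
  · rintro ⟨s, hs', t, ht, h⟩
    refine ⟨(D.curve e s).1, (abscissa_mem_innerSpan_iff hs hm e s).2 hs', ?_, ?_⟩
    · rw [h]; exact (abscissa_mem_innerSpan_iff hs hm f t).2 ht
    · rw [height_abscissa hs hm, h, height_abscissa hs hm]
  · rintro ⟨x, h1, h2, h3⟩
    obtain ⟨s, hs1, hs2⟩ := exists_curve_eq_of_mem_innerSpan hs hm e h1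
    obtain ⟨t, ht1, ht2⟩ := exists_curve_eq_of_mem_innerSpan hs hm f h2
    exact ⟨s, hs1, t, ht1, by rw [hs2, ht2, h3]⟩

/-- A meeting point over both inner spans is not an endpoint, so simplicity makes it a proper
crossing; one edge staying above the other on both sides would be a mere touching. -/
theorem not_eventually_height_lt {e f : BEdge m n} (hef : e ≠ f) {x : ℝ} (h1 : x ∈ D.innerSpan e)
    (h2 : x ∈ D.innerSpan f) (h3 : D.height e x = D.height f x) :
    ¬ ∀ᶠ z in 𝓝[≠] x, D.height e z < D.height f z := by
  intro hev
  obtain ⟨s, hs1, hs2⟩ := exists_curve_eq_of_mem_innerSpan hs hm e h1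
  obtain ⟨t, ht1, ht2⟩ := exists_curve_eq_of_mem_innerSpan hs hm f h2
  have hst : D.curve e s = D.curve f t := by rw [hs2, ht2, h3]
  have hpc : IsProperCrossing (Set.range (D.curve e)) (Set.range (D.curve f)) (D.curve e s) := by
    rcases hs.meet_properly e f hef s t hst with ⟨v, hv, -, hv'⟩ | ⟨-, -, h⟩
    · exfalso
      rcases hv with rfl | rfl
      · exact hs1.1.ne' (hs.curve_injective e (hv'.trans (D.curve e).source.symm))
      · exact hs1.2.ne (hs.curve_injective e (hv'.trans (D.curve e).target.symm))
    · exact h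
  have hopen : ∀ᶠ z in 𝓝 x, z ∈ D.innerSpan e ∧ z ∈ D.innerSpan f ∧
      (z ≠ x → D.height e z < D.height f z) :=
    (isOpen_Ioo.eventually_mem h1).and ((isOpen_Ioo.eventually_mem h2).and
      (eventually_nhdsWithin_iff.1 hev))
  obtain ⟨δ, hδ, hb⟩ := Metric.eventually_nhds_iff_ball.1 hopen
  rw [Real.ball_eq_Ioo] at hb
  have hsp : ∀ {g : BEdge m n} {z}, z ∈ D.innerSpan g → z ∈ D.span g := fun h => ⟨h.1.le, h.2.le⟩
  rw [hst, ht2] at hpc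
  exact not_isProperCrossing_of_lt hδ
    ((continuousOn_height hs hm f).mono fun z hz => hsp (hb z hz).2.1)
    (fun q hq => mem_range_curve_iff hs hm e (hsp (hb _ hq).1))
    (fun q hq => mem_range_curve_iff hs hm f (hsp (hb _ hq).2.1))
    (fun z hz => (hb z hz).2.2) hpc

omit hs hm

/-- A monotone drawing as a family of functions, the red vertices being listed first. -/
noncomputable def toMonoFamily (hs : D.IsSimple) (hm : D.IsXMonotone) :
    MonoFamily (Fin m) (Fin n) where
  X i := (D.pt (Sum.inl i)).1
  Y j := (D.pt (Sum.inr j)).1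
  hX i := (D.pt (Sum.inl i)).2
  hY j := (D.pt (Sum.inr j)).2
  F i j := D.height (i, j)
  ne i j := abscissa_ne hs hm (i, j)
  cont i j := continuousOn_height hs hm (i, j)
  F_X i j := height_source hs hm (i, j)
  F_Y i j := height_target hs hm (i, j)
  avoidX i j _ h hx := height_ne_of_not_incident hs hm (i, j) (by simpa [BIncident] using h) hx
  avoidY i j _ h hx := height_ne_of_not_incident hs hm (i, j) (by simpa [BIncident] using h) hx
  once _ _ _ _ h _ _ h1 h2 h3 h4 h5 h6 := height_meet_once hs hm h h1 h2 h3 h4 h5 h6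
  proper _ _ _ _ h _ h1 h2 h3 := not_eventually_height_lt hs hm h h1 h2 h3

/-- A monotone drawing as a family of functions, the blue vertices being listed first. -/
noncomputable def toMonoFamilySwap (hs : D.IsSimple) (hm : D.IsXMonotone) :
    MonoFamily (Fin n) (Fin m) where
  X j := (D.pt (Sum.inr j)).1
  Y i := (D.pt (Sum.inl i)).1
  hX j := (D.pt (Sum.inr j)).2
  hY i := (D.pt (Sum.inl i)).2
  F j i := D.height (i, j)
  ne j i := (abscissa_ne hs hm (i, j)).symm
  cont j i := by
    rw [Set.uIcc_comm]
    exact continuousOn_height hs hm (i, j)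
  F_X j i := height_target hs hm (i, j)
  F_Y j i := height_source hs hm (i, j)
  avoidX j i _ h hx := by
    rw [Set.uIcc_comm] at hx
    exact height_ne_of_not_incident hs hm (i, j) (by simpa [BIncident] using h) hx
  avoidY j i _ h hx := by
    rw [Set.uIcc_comm] at hx
    exact height_ne_of_not_incident hs hm (i, j) (by simpa [BIncident] using h) hx
  once j i j' i' h _ _ h1 h2 h3 h4 h5 h6 := by
    rw [Set.uIcc_comm] at h1 h2 h3 h4
    exact height_meet_once hs hm (e := (i, j)) (f := (i', j'))
      (fun he => h (by simpa [and_comm] using he)) h1 h2 h3 h4 h5 h6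
  proper j i j' i' h _ h1 h2 h3 := by
    rw [Set.uIoo_comm] at h1 h2
    exact not_eventually_height_lt hs hm (e := (i, j)) (f := (i', j'))
      (fun he => h (by simpa [and_comm] using he)) h1 h2 h3

theorem toMonoFamily_cross (hs : D.IsSimple) (hm : D.IsXMonotone) {e f : BEdge m n} :
    (D.toMonoFamily hs hm).Cross e.1 e.2 f.1 f.2 ↔ D.Crosses e f :=
  (crosses_iff hs hm).symm

theorem toMonoFamilySwap_cross (hs : D.IsSimple) (hm : D.IsXMonotone) {e f : BEdge m n} :
    (D.toMonoFamilySwap hs hm).Cross e.2 e.1 f.2 f.1 ↔ D.Crosses e f := by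
  rw [crosses_iff hs hm, MonoFamily.Cross]
  refine and_congr ?_ ?_
  · simp [Prod.ext_iff, and_comm]
  · simp only [toMonoFamilySwap, innerSpan, Set.uIoo_comm (D.pt (Sum.inr _)).1]

end BDrawing

/-! ### Program logic with step counts -/

namespace RamState

@[simp] theorem reg_setReg (s : RamState) (r x k : ℕ) :
    (s.setReg r x).reg k = if k = r then x else s.reg k := by
  simp [setReg, Function.update_apply]

@[simp] theorem mem_setReg (s : RamState) (r x : ℕ) : (s.setReg r x).mem = s.mem := rfl

@[simp] theorem reg_setMem (s : RamState) (a x : ℕ) : (s.setMem a x).reg = s.reg := rfl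

@[simp] theorem mem_setMem (s : RamState) (a x k : ℕ) :
    (s.setMem a x).mem k = if k = a then x else s.mem k := by
  simp [setMem, Function.update_apply]

end RamState

namespace RamProg

/-- The programs of a list, one after the other. -/
def block : List RamProg → RamProg
  | [] => skip
  | p :: l => seq p (block l)

/-- Started in `s`, the program `p` halts, and the number of steps and the final state satisfy
`Q`. -/
def Wp (W : ℕ) (p : RamProg) (s : RamState) (Q : ℕ → RamState → Prop) : Prop :=
  ∃ t s', RamExec W p s t s' ∧ Q t s'

variable {W : ℕ} {s : RamState} {Q R : ℕ → RamState → Prop}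

theorem Wp.mono {p : RamProg} (h : Wp W p s R) (hRQ : ∀ t s', R t s' → Q t s') : Wp W p s Q :=
  let ⟨t, s', h1, h2⟩ := h
  ⟨t, s', h1, hRQ t s' h2⟩

theorem wp_const {r k : ℕ} : Wp W (const r k) s Q ↔ k < W ∧ Q 1 (s.setReg r k) := by
  constructor
  · rintro ⟨t, s', h, hQ⟩
    cases h with | const _ _ _ h => exact ⟨h, hQ⟩
  · rintro ⟨h, hQ⟩
    exact ⟨_, _, .const s r k h, hQ⟩

theorem wp_plus {r a b : ℕ} : Wp W (plus r a b) s Q ↔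
    s.reg a + s.reg b < W ∧ Q 1 (s.setReg r (s.reg a + s.reg b)) := by
  constructor
  · rintro ⟨t, s', h, hQ⟩
    cases h with | plus _ _ _ _ h => exact ⟨h, hQ⟩
  · rintro ⟨h, hQ⟩
    exact ⟨_, _, .plus s r a b h, hQ⟩

theorem wp_minus {r a b : ℕ} : Wp W (minus r a b) s Q ↔
    Q 1 (s.setReg r (s.reg a - s.reg b)) := by
  constructor
  · rintro ⟨t, s', h, hQ⟩
    cases h
    exact hQ
  · exact fun hQ => ⟨_, _, .minus s r a b, hQ⟩

theorem wp_load {r a : ℕ} : Wp W (load r a) s Q ↔ Q 1 (s.setReg r (s.mem (s.reg a))) := by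
  constructor
  · rintro ⟨t, s', h, hQ⟩
    cases h
    exact hQ
  · exact fun hQ => ⟨_, _, .load s r a, hQ⟩

theorem wp_store {a b : ℕ} : Wp W (store a b) s Q ↔ Q 1 (s.setMem (s.reg a) (s.reg b)) := by
  constructor
  · rintro ⟨t, s', h, hQ⟩
    cases h
    exact hQ
  · exact fun hQ => ⟨_, _, .store s a b, hQ⟩

theorem wp_skip : Wp W skip s Q ↔ Q 1 s := by
  constructor
  · rintro ⟨t, s', h, hQ⟩
    cases h
    exact hQ
  · exact fun hQ => ⟨_, _, .skip s, hQ⟩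

theorem wp_seq {p q : RamProg} : Wp W (seq p q) s Q ↔
    Wp W p s fun t s' => Wp W q s' fun t' s'' => Q (t + t') s'' := by
  constructor
  · rintro ⟨t, s', h, hQ⟩
    cases h with | seq hp hq => exact ⟨_, _, hp, _, _, hq, hQ⟩
  · rintro ⟨_, _, hp, _, _, hq, hQ⟩
    exact ⟨_, _, .seq hp hq, hQ⟩

theorem wp_ifLt {a b : ℕ} {p q : RamProg} : Wp W (ifLt a b p q) s Q ↔
    if s.reg a < s.reg b then Wp W p s fun t => Q (1 + t) else Wp W q s fun t => Q (1 + t) := by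
  constructor
  · rintro ⟨t, s', h, hQ⟩
    cases h with
    | ifLt_true h hp => rw [if_pos h]; exact ⟨_, _, hp, hQ⟩
    | ifLt_false h hp => rw [if_neg h]; exact ⟨_, _, hp, hQ⟩
  · intro h
    split_ifs at h with hlt
    · obtain ⟨t, s', hp, hQ⟩ := h
      exact ⟨_, _, .ifLt_true hlt hp, hQ⟩
    · obtain ⟨t, s', hp, hQ⟩ := h
      exact ⟨_, _, .ifLt_false hlt hp, hQ⟩

theorem wp_block_nil : Wp W (block []) s Q ↔ Q 1 s := wp_skip

theorem wp_block_cons {p : RamProg} {l : List RamProg} : Wp W (block (p :: l)) s Q ↔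
    Wp W p s fun t s' => Wp W (block l) s' fun t' s'' => Q (t + t') s'' := wp_seq

/-- A loop with invariant `J`, every round of which is paid for by the potential `Φ`. -/
theorem wp_whileLt {a b : ℕ} {p : RamProg} (J : RamState → Prop) (Φ : RamState → ℕ)
    (hstep : ∀ s, J s → s.reg a < s.reg b →
      Wp W p s fun t s' => J s' ∧ t + 1 + Φ s' ≤ Φ s) (s : RamState) (hs : J s) :
    Wp W (whileLt a b p) s fun t s' =>
      J s' ∧ ¬ s'.reg a < s'.reg b ∧ t + Φ s' ≤ Φ s + 1 := by
  induction hk : Φ s using Nat.strong_induction_on generalizing s with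
  | _ k ih =>
    by_cases h : s.reg a < s.reg b
    · obtain ⟨t, s', hp, hI, ht⟩ := hstep s hs h
      obtain ⟨t', s'', hw, hI', hn, ht'⟩ := ih (Φ s') (by omega) s' hI rfl
      exact ⟨_, _, .whileLt_true h hp hw, hI', hn, by omega⟩
    -- The failing test costs one step that no round pays for; this is the `+ 1` in the bound.
    · exact ⟨_, _, .whileLt_false h, hs, h, by omega⟩

end RamProg

/-! ### The program and its abstract specification -/

namespace ShootingStarProgram

open RamProg

/-- Read the parameters of the input and compute the constants. -/
def setup : RamProg := block
  -- Registers 0 to 8 hold `N, 1, m, n, root, 0, 2N, 3N, m + n`. The memory is divided into the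
  -- input from 0 on, positions from `N`, best neighbours from `2N`, and output from `3N`.
  [const 1 1, const 5 0, load 2 5, load 3 1, const 15 2, load 4 15, plus 6 0 0, plus 7 6 0,
    plus 8 2 3]

/-- Store the position of every vertex, and find the last vertex of the class without the root. -/
def posLoop : RamProg := block
  [const 11 0,
    whileLt 11 8 (block
      [const 15 2, plus 15 15 11, load 15 15, plus 16 0 15, store 16 11,
        -- A code is red iff it is below `m`. The scan runs from left to right, so register 9 ends
        -- up with the last position in the other class.
        ifLt 4 2 (ifLt 15 2 skip (plus 9 11 5)) (ifLt 15 2 (plus 9 11 5) skip),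
        plus 11 11 1])]

/-- Initialize the table of neighbours. -/
def fillLoop : RamProg := block
  [const 11 0, whileLt 11 8 (block [plus 15 6 11, store 15 9, plus 11 11 1])]

/-- Find the address of the first list of crossings. -/
def skipLoop : RamProg := block
  [const 15 2, plus 10 15 8, const 11 0,
    -- There is no multiplication: the `2 * m * n` words of rotations are skipped by adding `n`
    -- twice for each red vertex.
    whileLt 11 2 (block [plus 10 10 3, plus 10 10 3, plus 11 11 1])]

/-- Find out whether the current list of crossings contains an edge at the root. -/
def scanLoop : RamProg := whileLt 10 14 (block
  [load 15 10, plus 10 10 1, load 16 10, plus 10 10 1, plus 16 16 2,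
    -- Equality with the root is the failure of both strict comparisons. Register 16 holds a blue
    -- index already shifted by `m`, that is, a vertex code.
    ifLt 15 4 skip (ifLt 4 15 skip (const 13 1)),
    ifLt 16 4 skip (ifLt 4 16 skip (const 13 1))])

/-- Find the codes of the endpoints of the current edge, the class of the root first. -/
def endpoints : RamProg :=
  ifLt 4 2 (block [plus 15 11 5, plus 16 2 12]) (block [plus 15 2 12, plus 16 11 5])

/-- Improve the neighbour of a vertex if the current edge allows this. -/
def improve : RamProg :=
  ifLt 13 1
    (block [plus 17 0 15, load 17 17, plus 18 0 16, load 18 18,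
      ifLt 17 18 (block [plus 19 6 15, load 20 19, ifLt 18 20 (store 19 18) skip]) skip])
    skip

/-- Process one list of crossings. -/
def edgeBody : RamProg := block
  [load 15 10, plus 10 10 1, plus 14 10 15, plus 14 14 15, const 13 0, scanLoop, endpoints, improve,
    plus 12 12 1]

/-- Process all lists of crossings. -/
def edgeLoop : RamProg := block
  [const 11 0,
    whileLt 11 2 (block
      [const 12 0,
        whileLt 12 3 edgeBody,
        plus 11 11 1])]

/-- Find out whether the current edge belongs to the shooting star. -/
def select : RamProg := block
  [const 13 0, ifLt 15 4 skip (ifLt 4 15 skip (const 13 1)),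
    plus 17 6 15, load 17 17, plus 18 0 16, load 18 18,
    ifLt 17 18 skip (ifLt 18 17 skip (const 13 1))]

/-- Write the current edge to the output if it has been selected. -/
def emit : RamProg :=
  ifLt 5 13 (block [store 10 11, plus 10 10 1, store 10 12, plus 10 10 1]) skip

/-- Write the output. -/
def outputLoop : RamProg := block
  [plus 10 7 5, const 11 0,
    whileLt 11 2 (block
      [const 12 0, whileLt 12 3 (block [endpoints, select, emit, plus 12 12 1]), plus 11 11 1]),
    plus 0 7 5, minus 1 10 0]

/-- The whole program. -/
def program : RamProg := block
  [setup, posLoop, fillLoop, skipLoop, edgeLoop, outputLoop]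

/-- What the program uses about the memory `M` in which it is started: `pos v` is the position of
the vertex `v`, and `off i j` is the address of the list of crossings of the edge `(i, j)`. -/
structure Input (m n N root : ℕ) (M pos : ℕ → ℕ) (off : ℕ → ℕ → ℕ) : Prop where
  m_pos : 0 < m
  n_pos : 0 < n
  mem_zero : M 0 = m
  mem_one : M 1 = n
  mem_two : M 2 = root
  order_lt : ∀ k < m + n, M (2 + k) < m + n
  pos_order : ∀ k < m + n, pos (M (2 + k)) = k
  pos_lt : ∀ v < m + n, pos v < m + n
  order_pos : ∀ v < m + n, M (2 + pos v) = v
  off_zero : off 0 0 = 2 + (m + n) + m * (2 * n)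
  off_succ : ∀ i < m, ∀ j < n, off i (j + 1) = off i j + 1 + 2 * M (off i j)
  off_row : ∀ i < m, off (i + 1) 0 = off i n
  off_last : off m 0 = N
  entry_lt : ∀ i < m, ∀ j < n, ∀ k < M (off i j), M (off i j + 1 + (2 * k + 1)) < n

/-- The endpoint of the edge `(i, j)` in the class of the root. -/
def near (m root i j : ℕ) : ℕ := if root < m then i else m + j

/-- The endpoint of the edge `(i, j)` in the class without the root. -/
def far (m root i j : ℕ) : ℕ := if root < m then m + j else i

/-- One of the first `len` edges in the list at the address `p` is an edge at the root. -/
def Hits (m root : ℕ) (M : ℕ → ℕ) (p len : ℕ) : Prop :=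
  ∃ k < len, M (p + 2 * k) = root ∨ M (p + (2 * k + 1)) + m = root

theorem hits_succ {m root : ℕ} {M : ℕ → ℕ} {p k : ℕ} : Hits m root M p (k + 1) ↔
    Hits m root M p k ∨ M (p + 2 * k) = root ∨ M (p + (2 * k + 1)) + m = root := by
  constructor
  · rintro ⟨k', h1, h2⟩
    rcases Nat.lt_succ_iff_lt_or_eq.1 h1 with h1 | rfl
    · exact Or.inl ⟨k', h1, h2⟩
    · exact Or.inr h2
  · rintro (⟨k', h1, h2⟩ | h)
    · exact ⟨k', by omega, h2⟩
    · exact ⟨k, by omega, h⟩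

/-- The list of crossings of the edge `(i, j)` contains an edge at the root. -/
def Hit (m root : ℕ) (M : ℕ → ℕ) (off : ℕ → ℕ → ℕ) (i j : ℕ) : Prop :=
  Hits m root M (off i j + 1) (M (off i j))

/-- The edge `(i, j)` leads to the right and crosses no edge at the root. -/
def Cand (m root : ℕ) (M pos : ℕ → ℕ) (off : ℕ → ℕ → ℕ) (i j : ℕ) : Prop :=
  ¬ Hit m root M off i j ∧ pos (near m root i j) < pos (far m root i j)

/-- The vertex `v` does not belong to the class of the root. -/
def IsFar (m root v : ℕ) : Prop := if root < m then m ≤ v else v < m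

/-- The table `b` holds the positions of the best neighbours among the edges in `P`. -/
def IsBest (C : ℕ → ℕ → Prop) (pos : ℕ → ℕ) (m n root last : ℕ) (P : ℕ → ℕ → Prop) (b : ℕ → ℕ) :
    Prop :=
  ∀ u < m + n, (b u = last ∨
      ∃ i j, P i j ∧ C i j ∧ near m root i j = u ∧ b u = pos (far m root i j)) ∧
    b u ≤ last ∧ ∀ i j, P i j → C i j → near m root i j = u → b u ≤ pos (far m root i j)

/-- One step of a running minimum: processing an edge affects only the table entry of its endpoint
in the root's class. -/
theorem IsBest.step {C : ℕ → ℕ → Prop} {pos : ℕ → ℕ} {m n root last : ℕ} {P P' : ℕ → ℕ → Prop}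
    {b b' : ℕ → ℕ} (h : IsBest C pos m n root last P b) {i₀ j₀ : ℕ}
    (hP : ∀ i j, P' i j ↔ P i j ∨ (i = i₀ ∧ j = j₀))
    (hne : ∀ u < m + n, u ≠ near m root i₀ j₀ → b' u = b u)
    (hyes : C i₀ j₀ → b' (near m root i₀ j₀) =
      min (b (near m root i₀ j₀)) (pos (far m root i₀ j₀)))
    (hno : ¬ C i₀ j₀ → b' (near m root i₀ j₀) = b (near m root i₀ j₀)) :
    IsBest C pos m n root last P' b' := by
  intro u hu
  obtain ⟨h1, h2, h3⟩ := h u hu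
  by_cases hun : u = near m root i₀ j₀
  · by_cases hc : C i₀ j₀
    · have hb := hyes hc
      rw [← hun] at hb
      refine ⟨?_, by omega, ?_⟩
      · rcases le_total (b u) (pos (far m root i₀ j₀)) with hle | hle
        · rw [min_eq_left hle] at hb
          rw [hb]
          refine h1.imp_right ?_
          rintro ⟨i, j, a1, a2⟩
          exact ⟨i, j, (hP i j).2 (Or.inl a1), a2⟩
        · rw [min_eq_right hle] at hb
          exact Or.inr ⟨i₀, j₀, (hP _ _).2 (Or.inr ⟨rfl, rfl⟩), hc, hun.symm, hb⟩
      · intro i j hij hcij hn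
        rcases (hP i j).1 hij with hij | ⟨rfl, rfl⟩
        · have := h3 i j hij hcij hn
          omega
        · omega
    · have hb := hno hc
      rw [← hun] at hb
      rw [hb]
      refine ⟨h1.imp_right ?_, h2, ?_⟩
      · rintro ⟨i, j, a1, a2⟩
        exact ⟨i, j, (hP i j).2 (Or.inl a1), a2⟩
      · intro i j hij hcij hn
        rcases (hP i j).1 hij with hij | ⟨rfl, rfl⟩
        · exact h3 i j hij hcij hn
        · exact absurd hcij hc
  · rw [hne u hu hun]
    refine ⟨h1.imp_right ?_, h2, ?_⟩
    · rintro ⟨i, j, a1, a2⟩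
      exact ⟨i, j, (hP i j).2 (Or.inl a1), a2⟩
    · intro i j hij hcij hn
      rcases (hP i j).1 hij with hij | ⟨rfl, rfl⟩
      · exact h3 i j hij hcij hn
      · exact absurd hn.symm hun

/-- The values of the registers that do not change after the setup. -/
structure Env (m n N root : ℕ) (s : RamState) : Prop where
  r0 : s.reg 0 = N
  r1 : s.reg 1 = 1
  r2 : s.reg 2 = m
  r3 : s.reg 3 = n
  r4 : s.reg 4 = root
  r5 : s.reg 5 = 0
  r6 : s.reg 6 = 2 * N
  r7 : s.reg 7 = 3 * N
  r8 : s.reg 8 = m + n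

theorem Env.setReg_iff {m n N root : ℕ} {s : RamState} {r x : ℕ} (hr : 8 < r) :
    Env m n N root (s.setReg r x) ↔ Env m n N root s := by
  have hne : ∀ k ≤ 8, k ≠ r := fun k hk => by omega
  constructor
  · rintro ⟨h0, h1, h2, h3, h4, h5, h6, h7, h8⟩
    constructor <;> simp_all
  · rintro ⟨h0, h1, h2, h3, h4, h5, h6, h7, h8⟩
    constructor <;> simp_all

theorem Env.setMem_iff {m n N root : ℕ} {s : RamState} {a x : ℕ} :
    Env m n N root (s.setMem a x) ↔ Env m n N root s :=
  ⟨fun ⟨h0, h1, h2, h3, h4, h5, h6, h7, h8⟩ => ⟨h0, h1, h2, h3, h4, h5, h6, h7, h8⟩,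
    fun ⟨h0, h1, h2, h3, h4, h5, h6, h7, h8⟩ => ⟨h0, h1, h2, h3, h4, h5, h6, h7, h8⟩⟩

namespace Input

variable {m n N root : ℕ} {M pos : ℕ → ℕ} {off : ℕ → ℕ → ℕ} (h : Input m n N root M pos off)
include h

theorem off_le_row {i j : ℕ} (hi : i < m) (hj : j ≤ n) : off i j ≤ off i n := by
  induction hj using Nat.decreasingInduction with
  | self => exact le_rfl
  | of_succ j hj ih => have := h.off_succ i hi j hj; omega

theorem off_row_le {i : ℕ} (hi : i ≤ m) : off i 0 ≤ N := by
  induction hi using Nat.decreasingInduction with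
  | self => exact h.off_last.le
  | of_succ i hi ih =>
    have := h.off_row i hi
    have := h.off_le_row hi (Nat.zero_le n)
    omega

theorem off_le {i j : ℕ} (hi : i < m) (hj : j ≤ n) : off i j ≤ N :=
  (h.off_le_row hi hj).trans ((h.off_row i hi).symm.le.trans (h.off_row_le hi))

/-- This inequality makes the time linear: it pays for visiting all `m * n` edges and bounds the
size of the output. -/
theorem size_le : 2 + (m + n) + m * (2 * n) ≤ N := h.off_zero ▸ h.off_row_le (Nat.zero_le m)

end Input

theorem near_lt {m n root i j : ℕ} (hi : i < m) (hj : j < n) : near m root i j < m + n := by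
  unfold near; split_ifs <;> omega

theorem far_lt {m n root i j : ℕ} (hi : i < m) (hj : j < n) : far m root i j < m + n := by
  unfold far; split_ifs <;> omega


/-! ### Verification: setup, positions, defaults -/

section Verification

variable {m n N root : ℕ} {M pos : ℕ → ℕ} {off : ℕ → ℕ → ℕ}

theorem wp_setup (h : Input m n N root M pos off) {s : RamState} (h0 : s.reg 0 = N)
    (hM : ∀ a < N, s.mem a = M a) :
    Wp (1000 * N) setup s fun t s' => t ≤ 10 ∧ Env m n N root s' ∧ s'.mem = s.mem := by
  have hsz := h.size_le
  have hm := h.m_pos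
  have hn := h.n_pos
  have e0 := hM 0 (by omega)
  have e1 := hM 1 (by omega)
  have e2 := hM 2 (by omega)
  rw [h.mem_zero] at e0
  rw [h.mem_one] at e1
  rw [h.mem_two] at e2
  simp only [setup, wp_block_cons, wp_block_nil, wp_const, wp_plus, wp_load]
  simp [h0, e0, e1, e2]
  refine ⟨by omega, by omega, by omega, by omega, by omega, ?_⟩
  exact ⟨by omega, by constructor <;> simp <;> omega⟩

theorem wp_posLoop (h : Input m n N root M pos off) {s : RamState} (he : Env m n N root s)
    (hM : ∀ a < N, s.mem a = M a) :
    Wp (1000 * N) posLoop s fun t s' => t ≤ 40 * N ∧ Env m n N root s' ∧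
      (∀ a < N, s'.mem a = M a) ∧ (∀ v < m + n, s'.mem (N + v) = pos v) ∧
      IsFar m root (M (2 + s'.reg 9)) ∧ s'.reg 9 < m + n ∧
      ∀ k < m + n, IsFar m root (M (2 + k)) → k ≤ s'.reg 9 := by
  have hsz := h.size_le
  have hm := h.m_pos
  have hn := h.n_pos
  simp only [posLoop, wp_block_cons, wp_block_nil, wp_const]
  refine ⟨by omega, Wp.mono (wp_whileLt (fun s => Env m n N root s ∧ (∀ a < N, s.mem a = M a) ∧
    s.reg 11 ≤ m + n ∧ (∀ k < s.reg 11, s.mem (N + M (2 + k)) = k) ∧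
    ∀ k < s.reg 11, IsFar m root (M (2 + k)) →
      IsFar m root (M (2 + s.reg 9)) ∧ s.reg 9 < s.reg 11 ∧ k ≤ s.reg 9)
    (fun s => 20 * (m + n - s.reg 11)) ?_ _ ?_) ?_⟩
  · rintro s ⟨he, hM, hk, hpos, hfar⟩ hlt
    rw [he.r8] at hlt
    have hv := hM (2 + s.reg 11) (by omega)
    have hvlt := h.order_lt _ hlt
    -- The vertices in the order are distinct, so storing a new position overwrites no earlier one.
    have hinj : ∀ k < s.reg 11, M (2 + k) ≠ M (2 + s.reg 11) := fun k hk' heq => by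
      have h1 := h.pos_order k (by omega)
      rw [heq, h.pos_order _ hlt] at h1
      omega
    have hpos' : ∀ k < s.reg 11 + 1,
        (if M (2 + k) = M (2 + s.reg 11) then s.reg 11 else s.mem (N + M (2 + k))) = k := by
      intro k hk'
      rcases Nat.lt_succ_iff_lt_or_eq.1 hk' with hk' | rfl
      · rw [if_neg (hinj k hk'), hpos k hk']
      · simp
    have hMne : ∀ a < N, a ≠ N + M (2 + s.reg 11) := fun a ha => by omega
    have hstay : ¬ IsFar m root (M (2 + s.reg 11)) → ∀ k ≤ s.reg 11, IsFar m root (M (2 + k)) →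
        IsFar m root (M (2 + s.reg 9)) ∧ s.reg 9 ≤ s.reg 11 ∧ k ≤ s.reg 9 := by
      intro hn k hk' hf
      have hlt' : k < s.reg 11 := lt_of_le_of_ne hk' (by rintro rfl; exact hn hf)
      obtain ⟨h1, h2, h3⟩ := hfar k hlt' hf
      exact ⟨h1, h2.le, h3⟩
    simp only [wp_block_cons, wp_block_nil, wp_const, wp_plus, wp_load, wp_store, wp_ifLt, wp_skip]
    by_cases hr : root < m <;> by_cases hvm : M (2 + s.reg 11) < m <;>
      simp only [IsFar, hr, if_true, if_false, hvm] at hstay <;>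
      simp [he.r0, he.r1, he.r2, he.r4, he.r5, hv, hr, hvm, Env.setReg_iff, Env.setMem_iff, he,
        hlt, IsFar]
    all_goals refine ⟨by omega, by omega, by omega, by omega, ?_⟩
    all_goals try refine ⟨by omega, ?_⟩
    all_goals refine ⟨⟨fun a ha => by rw [if_neg (hMne a ha), hM a ha],
      fun k hk => hpos' k (Nat.lt_succ_of_le hk), ?_⟩, by omega⟩
    · simpa [IsFar, hr] using hstay (by omega)
    · exact fun k hk' _ => ⟨by omega, hk'⟩
    · exact fun k hk' _ => hk'
    · simpa [IsFar, hr] using hstay (by simp)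
  · simp [Env.setReg_iff, he]
    exact hM
  · rintro t s' ⟨⟨he', hM', hk, hpos, hfar⟩, hge, ht⟩
    rw [he'.r8] at hge
    have hk : s'.reg 11 = m + n := by omega
    rw [hk] at hpos hfar
    -- Both classes are nonempty, so register 9 has really been set and is not just its initial
    -- value.
    obtain ⟨k, hk1, hk2⟩ : ∃ k < m + n, IsFar m root (M (2 + k)) := by
      by_cases hr : root < m
      · exact ⟨pos m, h.pos_lt m (by omega), by simp [IsFar, hr, h.order_pos m (by omega)]⟩
      · exact ⟨pos 0, h.pos_lt 0 (by omega), by simp [IsFar, hr, h.order_pos 0 (by omega), hm]⟩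
    obtain ⟨f1, f2, -⟩ := hfar k hk1 hk2
    refine ⟨by omega, he', hM', fun v hv => ?_, f1, f2, fun k hk hf => (hfar k hk hf).2.2⟩
    have := hpos (pos v) (h.pos_lt v hv)
    rwa [h.order_pos v hv] at this

theorem wp_fillLoop (h : Input m n N root M pos off) {s : RamState} (he : Env m n N root s)
    (hM : ∀ a < N, s.mem a = M a) (hp : ∀ v < m + n, s.mem (N + v) = pos v)
    (h9 : s.reg 9 < m + n) :
    Wp (1000 * N) fillLoop s fun t s' => t ≤ 40 * N ∧ Env m n N root s' ∧
      (∀ a < N, s'.mem a = M a) ∧ (∀ v < m + n, s'.mem (N + v) = pos v) ∧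
      s'.reg 9 = s.reg 9 ∧ ∀ u < m + n, s'.mem (2 * N + u) = s.reg 9 := by
  have hsz := h.size_le
  have hm := h.m_pos
  have hn := h.n_pos
  simp only [fillLoop, wp_block_cons, wp_block_nil, wp_const]
  refine ⟨by omega, Wp.mono (wp_whileLt (fun s' => Env m n N root s' ∧ (∀ a < N, s'.mem a = M a) ∧
    s'.reg 11 ≤ m + n ∧ (∀ v < m + n, s'.mem (N + v) = pos v) ∧ s'.reg 9 = s.reg 9 ∧
    ∀ u < s'.reg 11, s'.mem (2 * N + u) = s.reg 9)
    (fun s' => 10 * (m + n - s'.reg 11)) ?_ _ ?_) ?_⟩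
  · rintro s' ⟨he, hM, hk, hpos, h9', hb⟩ hlt
    rw [he.r8] at hlt
    simp only [wp_block_cons, wp_block_nil, wp_plus, wp_store]
    simp [he.r1, he.r6, h9', Env.setReg_iff, Env.setMem_iff, he, hlt]
    refine ⟨by omega, by omega, ⟨fun a ha => ?_, fun v hv => ?_, fun u hu => ?_⟩, by omega⟩
    · rw [if_neg (by omega), hM a ha]
    · rw [if_neg (by omega), hpos v hv]
    · exact fun hc => hb u (by omega)
  · simpa [Env.setReg_iff, he] using ⟨hM, hp⟩
  · rintro t s' ⟨⟨he', hM', hk, hpos, h9', hb⟩, hge, ht⟩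
    rw [he'.r8] at hge
    exact ⟨by omega, he', hM', hpos, h9', fun u hu => hb u (by omega)⟩

theorem wp_skipLoop (h : Input m n N root M pos off) {s : RamState} (he : Env m n N root s) :
    Wp (1000 * N) skipLoop s fun t s' => t ≤ 40 * N ∧ Env m n N root s' ∧
      s'.mem = s.mem ∧ s'.reg 9 = s.reg 9 ∧ s'.reg 10 = off 0 0 := by
  have hsz := h.size_le
  have hm := h.m_pos
  have hn := h.n_pos
  simp only [skipLoop, wp_block_cons, wp_block_nil, wp_const, wp_plus]
  simp only [RamState.reg_setReg, he.r8]
  refine ⟨by omega, by simp; omega, by omega, Wp.mono (wp_whileLt (fun s' => Env m n N root s' ∧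
    s'.mem = s.mem ∧ s'.reg 11 ≤ m ∧ s'.reg 9 = s.reg 9 ∧
    s'.reg 10 = 2 + (m + n) + s'.reg 11 * (2 * n))
    (fun s' => 10 * (m - s'.reg 11)) ?_ _ ?_) ?_⟩
  · rintro s' ⟨he, hM, hk, h9, h10⟩ hlt
    rw [he.r2] at hlt
    have hmul : (s'.reg 11 + 1) * (2 * n) ≤ m * (2 * n) := Nat.mul_le_mul_right _ hlt
    rw [Nat.succ_mul] at hmul
    simp only [wp_block_cons, wp_block_nil, wp_plus]
    simp [he.r1, he.r3, h9, h10, hM, Env.setReg_iff, he, add_mul]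
    omega
  · simp [Env.setReg_iff, he]
  · rintro t s' ⟨⟨he', hM', hk, h9', hb⟩, hge, ht⟩
    rw [he'.r2] at hge
    have hk : s'.reg 11 = m := by omega
    rw [hk] at hb
    have := Nat.le_mul_of_pos_right m (show 0 < 2 * n by omega)
    exact ⟨by omega, he', hM', h9', by rw [hb, h.off_zero]⟩

end Verification

end ShootingStarProgram

/-! ### Verification: the pass over the lists of crossings -/

namespace ShootingStarProgram
open RamProg
section Edges
variable {m n N root : ℕ} {M pos : ℕ → ℕ} {off : ℕ → ℕ → ℕ}

theorem wp_scanLoop {s : RamState} (he : Env m n N root s) (hmn : m + n ≤ N)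
    (hM : ∀ a < N, s.mem a = M a) {p len : ℕ} (h10 : s.reg 10 = p) (h14 : s.reg 14 = p + 2 * len)
    (h13 : s.reg 13 = 0) (hp : p + 2 * len ≤ N) (hent : ∀ k < len, M (p + (2 * k + 1)) < n) :
    Wp (1000 * N) scanLoop s fun t s' => t ≤ 40 * len + 1 ∧ Env m n N root s' ∧
      s'.mem = s.mem ∧ s'.reg 9 = s.reg 9 ∧ s'.reg 11 = s.reg 11 ∧ s'.reg 12 = s.reg 12 ∧
      s'.reg 10 = p + 2 * len ∧ (s'.reg 13 = 0 ↔ ¬ Hits m root M p len) := by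
  refine Wp.mono (wp_whileLt (fun s' => Env m n N root s' ∧
      s'.mem = s.mem ∧ s'.reg 9 = s.reg 9 ∧ s'.reg 11 = s.reg 11 ∧ s'.reg 12 = s.reg 12 ∧
      s'.reg 14 = p + 2 * len ∧ ∃ k ≤ len, s'.reg 10 = p + 2 * k ∧
      (s'.reg 13 = 0 ↔ ¬ Hits m root M p k))
      (fun s' => 20 * (p + 2 * len - s'.reg 10)) ?_ _ ?_) ?_
  · rintro s' ⟨he, hmem, h9, h11, h12, h14, k, hk, h10, h13⟩ hlt
    rw [h10, h14] at hlt
    have ha := hM (p + 2 * k) (by omega)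
    have hb := hM (p + (2 * k + 1)) (by omega)
    have hbn := hent k (by omega)
    have hsucc := hits_succ (m := m) (root := root) (M := M) (p := p) (k := k)
    rw [← add_assoc] at hb hbn hsucc
    have hyes : M (p + 2 * k) = root ∨ M (p + 2 * k + 1) + m = root →
        ∃ k₁ ≤ len, p + 2 * k + 1 + 1 = p + 2 * k₁ ∧ Hits m root M p k₁ := fun hc =>
      ⟨k + 1, by omega, by ring, hsucc.2 (Or.inr hc)⟩
    have hno : ¬ (M (p + 2 * k) = root ∨ M (p + 2 * k + 1) + m = root) →
        ∃ k₁ ≤ len, p + 2 * k + 1 + 1 = p + 2 * k₁ ∧ (s'.reg 13 = 0 ↔ ¬ Hits m root M p k₁) :=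
      fun hc => ⟨k + 1, by omega, by ring, by rw [h13, hsucc, or_iff_left hc]⟩
    simp only [wp_block_cons, wp_block_nil, wp_const, wp_plus, wp_load, wp_ifLt, wp_skip]
    rcases lt_trichotomy (M (p + 2 * k)) root with h1 | h1 | h1 <;>
      rcases lt_trichotomy (M (p + 2 * k + 1) + m) root with h2 | h2 | h2 <;>
      simp [he.r1, he.r2, he.r4, h9, h10, h11, h12, h14, hmem, ha, hb, Env.setReg_iff, he, h1, h2,
        h1.not_gt, h2.not_gt]
    all_goals refine ⟨by omega, by omega, by omega, ?_⟩
    all_goals try refine ⟨by omega, ?_⟩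
    all_goals refine ⟨?_, by omega⟩
    all_goals first | exact hyes (by omega) | exact hno (by omega)
  · simp [he, h10, h13, h14]
    exact fun ⟨k, hk, _⟩ => absurd hk (Nat.not_lt_zero k)
  · rintro t s' ⟨⟨he, hmem, h9, h11, h12, h14, k, hk, h10, h13⟩, hge, ht⟩
    rw [h10, h14] at hge
    obtain rfl : k = len := by omega
    exact ⟨by omega, he, hmem, h9, h11, h12, h10, h13⟩

theorem wp_endpoints {s : RamState} (he : Env m n N root s) (hi : s.reg 11 < m)
    (hj : s.reg 12 < n) (hmn : m + n ≤ N) :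
    Wp (1000 * N) endpoints s fun t s' => t ≤ 5 ∧ Env m n N root s' ∧ s'.mem = s.mem ∧
      (∀ r < 15, s'.reg r = s.reg r) ∧
      s'.reg 15 = near m root (s.reg 11) (s.reg 12) ∧
      s'.reg 16 = far m root (s.reg 11) (s.reg 12) := by
  simp only [endpoints, wp_block_cons, wp_block_nil, wp_plus, wp_ifLt]
  by_cases hr : root < m <;>
    simp [he.r2, he.r4, he.r5, hr, Env.setReg_iff, he, near, far]
  all_goals refine ⟨by omega, by omega, fun r hr => ?_⟩
  all_goals split_ifs <;> omega

theorem wp_improve {s : RamState} (he : Env m n N root s) (hmn : m + n ≤ N) (hN : 0 < N)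
    (hp : ∀ v < m + n, s.mem (N + v) = pos v) {u w : ℕ} (h15 : s.reg 15 = u) (hu : u < m + n)
    (h16 : s.reg 16 = w) (hw : w < m + n) :
    Wp (1000 * N) improve s fun t s' => t ≤ 20 ∧ Env m n N root s' ∧
      (∀ r < 15, s'.reg r = s.reg r) ∧ (∀ a, a ≠ 2 * N + u → s'.mem a = s.mem a) ∧
      s'.mem (2 * N + u) = if s.reg 13 = 0 ∧ pos u < pos w then min (s.mem (2 * N + u)) (pos w)
        else s.mem (2 * N + u) := by
  simp only [improve, wp_block_cons, wp_block_nil, wp_plus, wp_load, wp_store, wp_ifLt, wp_skip]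
  by_cases h1 : s.reg 13 = 0 <;> by_cases h2 : pos u < pos w <;>
    by_cases h3 : pos w < s.mem (2 * N + u) <;>
    simp [he.r0, he.r1, he.r6, h15, h16, hp u hu, hp w hw, Env.setReg_iff, Env.setMem_iff, he, h1,
      h2, h3]
  · refine ⟨by omega, by omega, by omega, ⟨fun r hr => by split_ifs <;> omega, ?_, h3.le⟩⟩
    exact fun a ha hc => absurd hc ha
  · exact ⟨by omega, by omega, by omega, fun r hr => by split_ifs <;> omega, not_lt.1 h3⟩
  all_goals exact ⟨by omega, by omega, fun r hr => by split_ifs <;> omega⟩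

/-- The pointer in register 10 advances by `1 + 2 * len`, where `len` is the number of crossings on
the edge. The potential `60 * (N - reg 10)` thus drops by `60 + 120 * len`, which covers the scan
and the constant overhead. -/
theorem wp_edgeBody (h : Input m n N root M pos off) {s : RamState} (he : Env m n N root s)
    (hM : ∀ a < N, s.mem a = M a) (hp : ∀ v < m + n, s.mem (N + v) = pos v) {i j : ℕ}
    (hi : i < m) (hj : j < n) (h11 : s.reg 11 = i) (h12 : s.reg 12 = j)
    (h10 : s.reg 10 = off i j) :
    Wp (1000 * N) edgeBody s fun t s' => t + 1 + 60 * (N - s'.reg 10) ≤ 60 * (N - off i j) ∧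
      Env m n N root s' ∧ (∀ a < N, s'.mem a = M a) ∧ (∀ v < m + n, s'.mem (N + v) = pos v) ∧
      s'.reg 11 = i ∧ s'.reg 12 = j + 1 ∧ s'.reg 10 = off i (j + 1) ∧
      (∀ u, u ≠ near m root i j → s'.mem (2 * N + u) = s.mem (2 * N + u)) ∧
      (Cand m root M pos off i j → s'.mem (2 * N + near m root i j) =
        min (s.mem (2 * N + near m root i j)) (pos (far m root i j))) ∧
      (¬ Cand m root M pos off i j → s'.mem (2 * N + near m root i j) =
        s.mem (2 * N + near m root i j)) := by
  have hsz := h.size_le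
  have hsucc := h.off_succ i hi j hj
  have hle := h.off_le hi (show j + 1 ≤ n from hj)
  have hlen := hM (off i j) (by omega)
  have hu := near_lt (root := root) hi hj
  have hw := far_lt (root := root) hi hj
  simp only [edgeBody, wp_block_cons, wp_block_nil, wp_const, wp_load, wp_plus]
  simp only [RamState.reg_setReg, RamState.mem_setReg, h10, hlen, he.r1]
  simp only [if_true, Nat.reduceEqDiff, if_false]
  refine ⟨by omega, by omega, by omega, by omega, ?_⟩
  refine Wp.mono (wp_scanLoop (m := m) (n := n) (root := root) (M := M) (p := off i j + 1) (len := M (off i j))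
    (by simp [Env.setReg_iff, he]) (by omega) (by simpa using hM) (by simp) (by simp; omega)
    (by simp) (by omega) (h.entry_lt i hi j hj)) ?_
  rintro t₁ s₁ ⟨ht₁, he₁, hmem₁, -, h11₁, h12₁, h10₁, h13₁⟩
  simp only [RamState.reg_setReg, RamState.mem_setReg] at hmem₁ h11₁ h12₁
  simp [h11] at h11₁
  simp [h12] at h12₁
  refine Wp.mono (wp_endpoints he₁ (by omega) (by omega) (by omega)) ?_
  rintro t₂ s₂ ⟨ht₂, he₂, hmem₂, hreg₂, h15₂, h16₂⟩
  rw [h11₁, h12₁] at h15₂ h16₂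
  rw [hmem₁] at hmem₂
  refine Wp.mono (wp_improve he₂ (by omega) (by omega) (by rwa [hmem₂]) h15₂ hu h16₂ hw) ?_
  rintro t₃ s₃ ⟨ht₃, he₃, hreg₃, hmem₃, hnear₃⟩
  rw [hmem₂] at hmem₃ hnear₃
  have e10 : s₃.reg 10 = off i (j + 1) := by
    rw [hreg₃ 10 (by omega), hreg₂ 10 (by omega), h10₁, hsucc]
  have e12 : s₃.reg 12 = j := by rw [hreg₃ 12 (by omega), hreg₂ 12 (by omega), h12₁]
  have e11 : s₃.reg 11 = i := by rw [hreg₃ 11 (by omega), hreg₂ 11 (by omega), h11₁]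
  have e13 : s₂.reg 13 = 0 ∧ pos (near m root i j) < pos (far m root i j) ↔
      Cand m root M pos off i j := by
    rw [hreg₂ 13 (by omega), h13₁]
    rfl
  simp only [e10, e12, e11, he₃.r1]
  rw [Env.setReg_iff (by omega)]
  refine ⟨by omega, by simp; omega, he₃, fun a ha => ?_, fun v hv => ?_, by simp, by simp, by simp,
    fun u hu => hmem₃ _ (by omega), fun hc => ?_, fun hc => ?_⟩
  · rw [hmem₃ a (by omega), hM a ha]
  · rw [hmem₃ _ (by omega), hp v hv]
  · rw [hnear₃, if_pos (e13.2 hc)]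
  · rw [hnear₃, if_neg (fun h' => hc (e13.1 h'))]

theorem wp_edgeLoop (h : Input m n N root M pos off) {s : RamState} (he : Env m n N root s)
    (hM : ∀ a < N, s.mem a = M a) (hp : ∀ v < m + n, s.mem (N + v) = pos v) {last : ℕ}
    (hb : ∀ u < m + n, s.mem (2 * N + u) = last)
    (h10 : s.reg 10 = off 0 0) :
    Wp (1000 * N) edgeLoop s fun t s' => t ≤ 100 * N ∧ Env m n N root s' ∧
      (∀ v < m + n, s'.mem (N + v) = pos v) ∧
      IsBest (Cand m root M pos off) pos m n root last (fun i j => i < m ∧ j < n)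
        (fun u => s'.mem (2 * N + u)) := by
  have hsz := h.size_le
  have hm := h.m_pos
  have hn := h.n_pos
  let C := Cand m root M pos off
  simp only [edgeLoop, wp_block_cons, wp_block_nil, wp_const]
  refine ⟨by omega, Wp.mono (wp_whileLt (fun s' => Env m n N root s' ∧ (∀ a < N, s'.mem a = M a) ∧
    (∀ v < m + n, s'.mem (N + v) = pos v) ∧ s'.reg 11 ≤ m ∧ s'.reg 10 = off (s'.reg 11) 0 ∧
    IsBest C pos m n root last (fun i j => i < s'.reg 11 ∧ j < n) (fun u => s'.mem (2 * N + u)))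
    -- The second summand pays for the overhead of each row, the first for the edges.
    (fun s' => 60 * (N - s'.reg 10) + 10 * (m - s'.reg 11)) ?_ _ ?_) ?_⟩
  · rintro s₁ ⟨he, hM, hp, hi, h10, hb⟩ hlt
    rw [he.r2] at hlt
    simp only [wp_block_cons, wp_block_nil, wp_const, wp_plus]
    refine ⟨by omega, Wp.mono (wp_whileLt (fun s' => Env m n N root s' ∧
      (∀ a < N, s'.mem a = M a) ∧ (∀ v < m + n, s'.mem (N + v) = pos v) ∧ s'.reg 12 ≤ n ∧
      s'.reg 11 = s₁.reg 11 ∧ s'.reg 10 = off (s₁.reg 11) (s'.reg 12) ∧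
      IsBest C pos m n root last
        (fun i j => i < s₁.reg 11 ∧ j < n ∨ i = s₁.reg 11 ∧ j < s'.reg 12)
        (fun u => s'.mem (2 * N + u)))
      (fun s' => 60 * (N - s'.reg 10)) ?_ _ ?_) ?_⟩
    · rintro s₂ ⟨he, hM, hp, hj, h11, h10, hb⟩ hjlt
      rw [he.r3] at hjlt
      refine Wp.mono (wp_edgeBody h he hM hp hlt hjlt h11 rfl h10) ?_
      rintro t s₃ ⟨ht, he, hM, hp, e11, e12, e10, e1, e2, e3⟩
      refine ⟨⟨he, hM, hp, by omega, e11, by rw [e10, e12], ?_⟩, by rwa [h10]⟩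
      refine hb.step (i₀ := s₁.reg 11) (j₀ := s₂.reg 12) (fun i j => ?_) (fun u _ hu => e1 u hu)
        e2 e3
      rw [e12]
      omega
    · simp only [RamState.reg_setReg, RamState.mem_setReg, Env.setReg_iff (show 8 < 12 by omega)]
      refine ⟨he, hM, hp, by simp, by simp, by simpa using h10, ?_⟩
      simpa using hb
    · rintro t s₂ ⟨⟨he, hM, hp, hj, h11, h10', hb⟩, hge, ht⟩
      rw [he.r3] at hge
      have hj : s₂.reg 12 = n := by omega
      rw [hj] at h10' hb
      have hP : ∀ i j, (i < s₁.reg 11 ∧ j < n ∨ i = s₁.reg 11 ∧ j < n) ↔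
          i < s₁.reg 11 + 1 ∧ j < n := fun i j => by omega
      simp only [hP] at hb
      have hrow := h.off_row _ hlt
      have hoff := h.off_le hlt le_rfl
      simp only [RamState.reg_setReg, RamState.mem_setReg, he.r1, h11, h10',
        Env.setReg_iff (show 8 < 11 by omega)] at ht ⊢
      simp only [if_true, Nat.reduceEqDiff, if_false] at ht ⊢
      refine ⟨by omega, ⟨he, hM, hp, by omega, hrow.symm, hb⟩, ?_⟩
      rw [h10] at ht ⊢
      omega
  · simp only [RamState.reg_setReg, RamState.mem_setReg, Env.setReg_iff (show 8 < 11 by omega)]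
    refine ⟨he, hM, hp, by simp, by simpa using h10, ?_⟩
    intro u hu
    exact ⟨Or.inl (hb u hu), (hb u hu).le, fun i j hij => by simp at hij⟩
  · rintro t s' ⟨⟨he, hM, hp, hi, h10', hb⟩, hge, ht⟩
    rw [he.r2] at hge
    have hi : s'.reg 11 = m := by omega
    rw [hi] at hb
    simp at ht
    exact ⟨by omega, he, hp, hb⟩

end Edges
end ShootingStarProgram

/-! ### Verification: writing the output -/

namespace ShootingStarProgram
open RamProg
section Output
variable {m n N root : ℕ} {M pos : ℕ → ℕ} {off : ℕ → ℕ → ℕ}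

/-- The edge `(i, j)` is incident to the root or leads to the chosen neighbour. -/
def Sel (m root : ℕ) (pos b : ℕ → ℕ) (i j : ℕ) : Prop :=
  near m root i j = root ∨ b (near m root i j) = pos (far m root i j)

open Classical in
/-- The output for the first `j` edges at the red vertex `i`. -/
noncomputable def rowOutput (m root : ℕ) (pos b : ℕ → ℕ) (i j : ℕ) : List ℕ :=
  (List.range j).flatMap fun j' => if Sel m root pos b i j' then [i, j'] else []

/-- The output for the edges at the first `i` red vertices. -/
noncomputable def tableOutput (m n root : ℕ) (pos b : ℕ → ℕ) (i : ℕ) : List ℕ :=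
  (List.range i).flatMap fun i' => rowOutput m root pos b i' n

/-- The words of `O` have been written to the addresses from `3 * N` on. -/
def Written (N : ℕ) (s : RamState) (O : List ℕ) : Prop :=
  s.reg 10 = 3 * N + O.length ∧ ∀ k < O.length, s.mem (3 * N + k) = O.getD k 0

theorem rowOutput_succ_pos {b : ℕ → ℕ} {i j : ℕ} (h : Sel m root pos b i j) :
    rowOutput m root pos b i (j + 1) = rowOutput m root pos b i j ++ [i, j] := by
  simp [rowOutput, List.range_succ, h]

theorem rowOutput_succ_neg {b : ℕ → ℕ} {i j : ℕ} (h : ¬ Sel m root pos b i j) :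
    rowOutput m root pos b i (j + 1) = rowOutput m root pos b i j := by
  simp [rowOutput, List.range_succ, h]

theorem wp_select {s : RamState} (he : Env m n N root s) (hmn : m + n ≤ N) (hN : 0 < N)
    (hp : ∀ v < m + n, s.mem (N + v) = pos v) {b : ℕ → ℕ}
    (hb : ∀ u < m + n, s.mem (2 * N + u) = b u) {u w : ℕ} (h15 : s.reg 15 = u) (hu : u < m + n)
    (h16 : s.reg 16 = w) (hw : w < m + n) :
    Wp (1000 * N) select s fun t s' => t ≤ 20 ∧ Env m n N root s' ∧ s'.mem = s.mem ∧
      (∀ r < 13, s'.reg r = s.reg r) ∧ (0 < s'.reg 13 ↔ u = root ∨ b u = pos w) := by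
  simp only [select, wp_block_cons, wp_block_nil, wp_const, wp_plus, wp_load, wp_ifLt, wp_skip]
  have hpw := hp _ hw
  have hbu := hb _ hu
  by_cases h1 : u < root <;> by_cases h2 : root < u <;> by_cases h3 : b u < pos w <;>
    by_cases h4 : pos w < b u <;>
    simp [he.r0, he.r4, he.r6, h15, h16, hpw, hbu, Env.setReg_iff, he, h1, h2, h3, h4]
  all_goals repeat' refine And.intro ?_ ?_
  all_goals first
    | omega
    | exact fun r hr => by split_ifs <;> omega

theorem wp_emit {s : RamState} (he : Env m n N root s) {i j : ℕ}
    (h11 : s.reg 11 = i) (h12 : s.reg 12 = j) (hout : s.reg 10 + 2 ≤ 6 * N) {O : List ℕ}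
    (hO : Written N s O) :
    Wp (1000 * N) emit s fun t s' => t ≤ 10 ∧ Env m n N root s' ∧
      (∀ a < 3 * N, s'.mem a = s.mem a) ∧ s'.reg 11 = i ∧ s'.reg 12 = j ∧
      s'.reg 10 ≤ s.reg 10 + 2 ∧ (0 < s.reg 13 → Written N s' (O ++ [i, j])) ∧
      (¬ 0 < s.reg 13 → Written N s' O) := by
  obtain ⟨h10, hO'⟩ := hO
  have hyes : ∀ s' : RamState, s'.reg 10 = 3 * N + O.length + 1 + 1 →
      (∀ a, s'.mem a = if a = 3 * N + O.length + 1 then j else if a = 3 * N + O.length then i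
        else s.mem a) → Written N s' (O ++ [i, j]) := by
    intro s' h1 h2
    refine ⟨by rw [h1]; simp; ring, fun k hk => ?_⟩
    rw [List.length_append] at hk
    rw [h2]
    simp only [List.length_cons, List.length_nil] at hk
    by_cases hk1 : k < O.length
    · rw [if_neg (by omega), if_neg (by omega), hO' k hk1, List.getD_append _ _ _ _ hk1]
    · rw [List.getD_append_right _ _ _ _ (by omega)]
      obtain rfl | rfl : k = O.length ∨ k = O.length + 1 := by omega
      · simp
      · rw [if_pos (by omega)]
        simp
  simp only [emit, wp_block_cons, wp_block_nil, wp_plus, wp_store, wp_ifLt, wp_skip]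
  rw [he.r5]
  rw [h10] at hout
  by_cases h : 0 < s.reg 13
  · rw [if_pos h]
    simp only [RamState.reg_setReg, RamState.mem_setReg, RamState.reg_setMem, RamState.mem_setMem,
      Env.setReg_iff (show 8 < 10 by omega), Env.setMem_iff, h10, h11, h12, he.r1]
    simp only [if_true, Nat.reduceEqDiff, if_false]
    refine ⟨by omega, by omega, by omega, he, fun a ha => ?_, trivial, trivial, by omega, ?_, ?_⟩
    · rw [if_neg (by omega), if_neg (by omega)]
    · exact fun _ => hyes _ (by simp) (by simp)
    · exact fun h' => absurd h h'
  · rw [if_neg h]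
    exact ⟨by omega, he, fun a _ => trivial, h11, h12, by omega, fun h' => absurd h' h,
      fun _ => ⟨h10, hO'⟩⟩

theorem wp_outputLoop (hsz : 2 + (m + n) + m * (2 * n) ≤ N) {s : RamState}
    (he : Env m n N root s) (hp : ∀ v < m + n, s.mem (N + v) = pos v) {b : ℕ → ℕ}
    (hb : ∀ u < m + n, s.mem (2 * N + u) = b u) :
    Wp (1000 * N) outputLoop s fun t s' => t ≤ 200 * N ∧
      s'.output = tableOutput m n root pos b m := by
  simp only [outputLoop, wp_block_cons, wp_block_nil, wp_const, wp_plus]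
  simp only [he.r7, he.r5]
  -- At most two words are written per edge, so the output fits into `2 * (m * n) ≤ N` words and all
  -- addresses stay below the word bound.
  have hmul : m * (2 * n) = 2 * (m * n) := by ring
  refine ⟨by omega, by omega, Wp.mono (wp_whileLt (fun s' => Env m n N root s' ∧
    (∀ v < m + n, s'.mem (N + v) = pos v) ∧ (∀ u < m + n, s'.mem (2 * N + u) = b u) ∧
    s'.reg 11 ≤ m ∧ s'.reg 10 ≤ 3 * N + 2 * (s'.reg 11 * n) ∧
    Written N s' (tableOutput m n root pos b (s'.reg 11)))
    (fun s' => (m - s'.reg 11) * (50 * n + 10)) ?_ _ ?_) ?_⟩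
  · rintro s₁ ⟨he, hp, hb, hi, h10, hw⟩ hlt
    rw [he.r2] at hlt
    have hle : (s₁.reg 11 + 1) * n ≤ m * n := Nat.mul_le_mul_right _ hlt
    rw [add_mul, one_mul] at hle
    simp only [wp_block_cons, wp_block_nil, wp_const, wp_plus]
    refine ⟨by omega, Wp.mono (wp_whileLt (fun s' => Env m n N root s' ∧
      (∀ v < m + n, s'.mem (N + v) = pos v) ∧ (∀ u < m + n, s'.mem (2 * N + u) = b u) ∧
      s'.reg 12 ≤ n ∧ s'.reg 11 = s₁.reg 11 ∧
      s'.reg 10 ≤ 3 * N + 2 * (s₁.reg 11 * n) + 2 * s'.reg 12 ∧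
      Written N s' (tableOutput m n root pos b (s₁.reg 11) ++
        rowOutput m root pos b (s₁.reg 11) (s'.reg 12)))
      (fun s' => 50 * (n - s'.reg 12)) ?_ _ ?_) ?_⟩
    · rintro s₂ ⟨he, hp, hb, hj, h11, h10, hw⟩ hjlt
      rw [he.r3] at hjlt
      simp only [wp_block_cons, wp_block_nil, wp_plus]
      have hu := near_lt (root := root) hlt hjlt
      have hv := far_lt (root := root) hlt hjlt
      refine Wp.mono (wp_endpoints he (by omega) (by omega) (by omega)) ?_
      rintro t₃ s₃ ⟨ht₃, he₃, hmem₃, hreg₃, h15₃, h16₃⟩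
      rw [h11] at h15₃ h16₃
      refine Wp.mono (wp_select he₃ (by omega) (by omega) (by rwa [hmem₃]) (by rwa [hmem₃]) h15₃
        hu h16₃ hv) ?_
      rintro t₄ s₄ ⟨ht₄, he₄, hmem₄, hreg₄, h13₄⟩
      rw [hmem₃] at hmem₄
      have e10 : s₄.reg 10 = s₂.reg 10 := by rw [hreg₄ 10 (by omega), hreg₃ 10 (by omega)]
      have e11 : s₄.reg 11 = s₁.reg 11 := by rw [hreg₄ 11 (by omega), hreg₃ 11 (by omega), h11]
      have e12 : s₄.reg 12 = s₂.reg 12 := by rw [hreg₄ 12 (by omega), hreg₃ 12 (by omega)]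
      have hw₄ : Written N s₄ (tableOutput m n root pos b (s₁.reg 11) ++
          rowOutput m root pos b (s₁.reg 11) (s₂.reg 12)) := by
        rwa [Written, e10, hmem₄]
      refine Wp.mono (wp_emit he₄ e11 e12 (by omega) hw₄) ?_
      rintro t₅ s₅ ⟨ht₅, he₅, hmem₅, f11, f12, f10, f1, f2⟩
      rw [hmem₄] at hmem₅
      simp only [RamState.reg_setReg, RamState.mem_setReg, f11, f12, he₅.r1,
        Env.setReg_iff (show 8 < 12 by omega)]
      simp only [if_true, Nat.reduceEqDiff, if_false]
      refine ⟨by omega, ⟨he₅, fun v hv => ?_, fun u hu => ?_, by omega, trivial, by omega, ?_⟩,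
        by omega⟩
      · rw [hmem₅ _ (by omega), hp v hv]
      · rw [hmem₅ _ (by omega), hb u hu]
      · have hcongr : ∀ O, Written N s₅ O → Written N (s₅.setReg 12 (s₂.reg 12 + 1)) O :=
          fun O hO => ⟨by simpa using hO.1, by simpa using hO.2⟩
        by_cases hsel : Sel m root pos b (s₁.reg 11) (s₂.reg 12)
        · rw [rowOutput_succ_pos hsel, ← List.append_assoc]
          exact hcongr _ (f1 (h13₄.2 hsel))
        · rw [rowOutput_succ_neg hsel]
          exact hcongr _ (f2 fun h' => hsel (h13₄.1 h'))
    · simp only [RamState.reg_setReg, RamState.mem_setReg, Env.setReg_iff (show 8 < 12 by omega)]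
      refine ⟨he, hp, hb, by simp, by simp, by simpa using h10, ?_⟩
      simpa [rowOutput, Written] using hw
    · rintro t s₂ ⟨⟨he, hp, hb, hj, h11, h10', hw⟩, hge, ht⟩
      rw [he.r3] at hge
      have hj : s₂.reg 12 = n := by omega
      rw [hj] at h10' hw
      simp only [RamState.reg_setReg, RamState.mem_setReg, he.r1, h11,
        Env.setReg_iff (show 8 < 11 by omega)] at ht ⊢
      simp only [if_true, Nat.reduceEqDiff, if_false] at ht ⊢
      have hnew : Written N (s₂.setReg 11 (s₁.reg 11 + 1))
          (tableOutput m n root pos b (s₁.reg 11 + 1)) := by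
        have : tableOutput m n root pos b (s₁.reg 11 + 1) = tableOutput m n root pos b (s₁.reg 11)
            ++ rowOutput m root pos b (s₁.reg 11) n := by
          simp [tableOutput, List.range_succ]
        rw [this]
        exact ⟨by simpa using hw.1, by simpa using hw.2⟩
      refine ⟨by omega, ⟨he, hp, hb, by omega, by rw [add_mul, one_mul]; omega, hnew⟩, ?_⟩
      obtain ⟨d, hd⟩ : ∃ d, m - s₁.reg 11 = d + 1 := ⟨m - s₁.reg 11 - 1, by omega⟩
      have hd' : m - (s₁.reg 11 + 1) = d := by omega
      rw [hd, hd', add_mul, one_mul]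
      omega
  · simp only [RamState.reg_setReg, RamState.mem_setReg, Env.setReg_iff (show 8 < 11 by omega),
      Env.setReg_iff (show 8 < 10 by omega)]
    exact ⟨he, hp, hb, by simp, by simp, by simp [Written, tableOutput]⟩
  · rintro t s' ⟨⟨he, hp, hb, hi, h10, hw⟩, hge, ht⟩
    rw [he.r2] at hge
    have hi : s'.reg 11 = m := by omega
    rw [hi] at hw
    simp only [wp_minus, RamState.reg_setReg, he.r7, he.r5] at ht ⊢
    simp only [if_true, Nat.reduceEqDiff, if_false] at ht ⊢
    refine ⟨by omega, ?_, ?_⟩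
    · have : (m - 0) * (50 * n + 10) = 50 * (m * n) + 10 * m := by rw [Nat.sub_zero]; ring
      omega
    · simp only [RamState.output, RamState.reg_setReg, RamState.mem_setReg]
      simp only [if_true, Nat.reduceEqDiff, if_false]
      refine List.ext_getElem (by simp [hw.1]) fun k h1 h2 => ?_
      simp only [List.getElem_map, List.getElem_range]
      simpa [h2] using hw.2 k h2

end Output

/-- The specification of the program. -/
theorem wp_program {m n N root : ℕ} {M pos : ℕ → ℕ} {off : ℕ → ℕ → ℕ}
    (h : Input m n N root M pos off) {s : RamState} (h0 : s.reg 0 = N) (hM : ∀ a, s.mem a = M a) :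
    ∃ last b, IsFar m root (M (2 + last)) ∧ last < m + n ∧
      (∀ k < m + n, IsFar m root (M (2 + k)) → k ≤ last) ∧
      IsBest (Cand m root M pos off) pos m n root last (fun i j => i < m ∧ j < n) b ∧
      Wp (1000 * N) program s fun t s' => t ≤ 1000 * N ∧
        s'.output = tableOutput m n root pos b m := by
  have hsz := h.size_le
  obtain ⟨t₁, s₁, x₁, ht₁, he₁, hm₁⟩ := wp_setup h h0 (fun a _ => hM a)
  have hM₁ : ∀ a < N, s₁.mem a = M a := fun a _ => by rw [hm₁, hM]
  obtain ⟨t₂, s₂, x₂, ht₂, he₂, hM₂, hp₂, a1, a2, a3⟩ := wp_posLoop h he₁ hM₁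
  obtain ⟨t₃, s₃, x₃, ht₃, he₃, hM₃, hp₃, h9₃, hb₃⟩ := wp_fillLoop h he₂ hM₂ hp₂ a2
  obtain ⟨t₄, s₄, x₄, ht₄, he₄, hm₄, -, h10₄⟩ := wp_skipLoop h he₃
  obtain ⟨t₅, s₅, x₅, ht₅, he₅, hp₅, hb₅⟩ := wp_edgeLoop h he₄ (by rwa [hm₄]) (by rwa [hm₄])
    (last := s₂.reg 9) (by rwa [hm₄]) h10₄
  obtain ⟨t₆, s₆, x₆, ht₆, ho₆⟩ := wp_outputLoop hsz he₅ hp₅ (b := fun u => s₅.mem (2 * N + u))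
    (fun _ _ => rfl)
  refine ⟨_, _, a1, a2, a3, hb₅, _, s₆, .seq x₁ (.seq x₂ (.seq x₃ (.seq x₄ (.seq x₅ (.seq x₆
    (.skip _)))))), by omega, ho₆⟩

end ShootingStarProgram

/-! ### Parent functions and spanning trees -/

/-- Sending a vertex other than `r` to its parent edge is surjective onto the edges, so there are at
most `|V| - 1` of them; a connected graph with so few edges is a tree. The value `par r` is
irrelevant. -/
theorem SimpleGraph.isTree_of_parent {V : Type*} [Finite V] {G : SimpleGraph V} {r : V}
    {par : V → V} (hadj : ∀ v ≠ r, G.Adj v (par v))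
    (hcov : ∀ a b, G.Adj a b → (a ≠ r ∧ b = par a) ∨ (b ≠ r ∧ a = par b))
    (htwo : ∀ v, v = r ∨ par v = r ∨ par (par v) = r) :
    G.IsTree ∧ ∀ v, G.dist r v ≤ 2 := by
  classical
  have hwalk : ∀ v, ∃ w : G.Walk r v, w.length ≤ 2 := by
    intro v
    by_cases hv : v = r
    · subst hv; exact ⟨.nil, by simp⟩
    by_cases hp : par v = r
    · exact ⟨.cons (hp ▸ (hadj v hv).symm) .nil, by simp⟩
    · have hpp : par (par v) = r := ((htwo v).resolve_left hv).resolve_left hp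
      exact ⟨.cons (hpp ▸ (hadj _ hp).symm) (.cons (hadj v hv).symm .nil), by simp⟩
  have hconn : G.Connected := by
    rw [SimpleGraph.connected_iff_exists_forall_reachable]
    exact ⟨r, fun v => (hwalk v).choose.reachable⟩
  refine ⟨?_, fun v => ?_⟩
  · rw [SimpleGraph.isTree_iff_connected_and_card]
    refine ⟨hconn, le_antisymm ?_ hconn.card_vert_le_card_edgeSet_add_one⟩
    have : Fintype V := Fintype.ofFinite V
    let f : {v // v ≠ r} → G.edgeSet := fun v => ⟨s(v.1, par v.1), hadj v.1 v.2⟩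
    have hf : Function.Surjective f := by
      rintro ⟨e, he⟩
      induction e with
      | _ a b =>
        rcases hcov a b he with ⟨ha, rfl⟩ | ⟨hb, rfl⟩
        · exact ⟨⟨a, ha⟩, rfl⟩
        · exact ⟨⟨b, hb⟩, Subtype.ext Sym2.eq_swap⟩
    have h1 := Nat.card_le_card_of_surjective f hf
    have h2 : Nat.card {v // v ≠ r} + 1 = Nat.card V := by
      have := Fintype.card_pos_iff.2 ⟨r⟩
      rw [Nat.card_eq_fintype_card, Nat.card_eq_fintype_card, Fintype.card_subtype_compl,
        Fintype.card_subtype_eq]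
      omega
    omega
  · obtain ⟨w, hw⟩ := hwalk v
    exact (SimpleGraph.dist_le w).trans hw

theorem bipartiteSubgraph_adj {m n : ℕ} {S : Set (BEdge m n)} {a b : BVertex m n} :
    (bipartiteSubgraph S).Adj a b ↔ ∃ e ∈ S, (a = Sum.inl e.1 ∧ b = Sum.inr e.2) ∨
      (a = Sum.inr e.2 ∧ b = Sum.inl e.1) := by
  simp only [bipartiteSubgraph, SimpleGraph.fromEdgeSet_adj, Set.mem_ofPred_eq, Sym2.eq_iff]
  constructor
  · rintro ⟨⟨e, he, h⟩, -⟩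
    exact ⟨e, he, h⟩
  · rintro ⟨e, he, h⟩
    refine ⟨⟨e, he, h⟩, ?_⟩
    rcases h with ⟨rfl, rfl⟩ | ⟨rfl, rfl⟩ <;> simp

namespace BDrawing

variable {m n : ℕ} {D : BDrawing m n} {S : Set (BEdge m n)}

theorem isShootingStar_inl {r : Fin m} {c : Fin m → Fin n}
    (hS : ∀ e, e ∈ S ↔ e.1 = r ∨ e.2 = c e.1) (hplane : ∀ e ∈ S, ∀ f ∈ S, ¬ D.Crosses e f) :
    D.IsShootingStar (Sum.inl r) S := by
  have key := SimpleGraph.isTree_of_parent (G := bipartiteSubgraph S) (r := Sum.inl r)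
    (par := Sum.elim (fun i => Sum.inr (c i)) fun _ => Sum.inl r) ?_ ?_ ?_
  · refine ⟨key.1, ?_, key.2, hplane⟩
    rintro e (h | h)
    · exact (hS e).2 (Or.inl (Sum.inl_injective h).symm)
    · simp at h
  · rintro (i | j) hv
    · exact bipartiteSubgraph_adj.2 ⟨(i, c i), (hS _).2 (Or.inr rfl), Or.inl ⟨rfl, rfl⟩⟩
    · exact bipartiteSubgraph_adj.2 ⟨(r, j), (hS _).2 (Or.inl rfl), Or.inr ⟨rfl, rfl⟩⟩
  · intro a b hab
    obtain ⟨⟨i, j⟩, he, h⟩ := bipartiteSubgraph_adj.1 hab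
    rw [hS] at he
    by_cases hi : i = r
    · subst hi
      rcases h with ⟨rfl, rfl⟩ | ⟨rfl, rfl⟩ <;> simp
    · have hj : j = c i := he.resolve_left hi
      subst hj
      rcases h with ⟨rfl, rfl⟩ | ⟨rfl, rfl⟩ <;> simp [hi]
  · rintro (i | j) <;> simp

theorem isShootingStar_inr {r : Fin n} {c : Fin n → Fin m}
    (hS : ∀ e, e ∈ S ↔ e.2 = r ∨ e.1 = c e.2) (hplane : ∀ e ∈ S, ∀ f ∈ S, ¬ D.Crosses e f) :
    D.IsShootingStar (Sum.inr r) S := by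
  have key := SimpleGraph.isTree_of_parent (G := bipartiteSubgraph S) (r := Sum.inr r)
    (par := Sum.elim (fun _ => Sum.inr r) fun j => Sum.inl (c j)) ?_ ?_ ?_
  · refine ⟨key.1, ?_, key.2, hplane⟩
    rintro e (h | h)
    · simp at h
    · exact (hS e).2 (Or.inl (Sum.inr_injective h).symm)
  · rintro (i | j) hv
    · exact bipartiteSubgraph_adj.2 ⟨(i, r), (hS _).2 (Or.inl rfl), Or.inl ⟨rfl, rfl⟩⟩
    · exact bipartiteSubgraph_adj.2 ⟨(c j, j), (hS _).2 (Or.inr rfl), Or.inr ⟨rfl, rfl⟩⟩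
  · intro a b hab
    obtain ⟨⟨i, j⟩, he, h⟩ := bipartiteSubgraph_adj.1 hab
    rw [hS] at he
    by_cases hj : j = r
    · subst hj
      rcases h with ⟨rfl, rfl⟩ | ⟨rfl, rfl⟩ <;> simp
    · have hi : i = c j := he.resolve_left hj
      subst hi
      rcases h with ⟨rfl, rfl⟩ | ⟨rfl, rfl⟩ <;> simp [hj]
  · rintro (i | j) <;> simp

end BDrawing

/-! ### From the table to a plane set of edges -/

namespace MonoFamily

variable {ι κ : Type*} {A : MonoFamily ι κ}

/-- A table of smallest positions of admissible neighbours, with the last position as the default,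
describes a plane set of edges. -/
theorem exists_choice_of_table [Finite κ] {r : ι} (hrX : ∀ i, A.X r ≤ A.X i)
    (hrY : ∀ j, A.X r < A.Y j) {q : κ → ℕ} (hinj : Function.Injective q)
    (hq : ∀ a b, q a < q b → A.Y a ≤ A.Y b) {b : ι → ℕ} {l : κ} (hl : ∀ j, q j ≤ q l)
    (h1 : ∀ i, b i = q l ∨ ∃ j, (A.Clear r i j ∧ A.X i < A.Y j) ∧ b i = q j)
    (h2 : ∀ i j, A.Clear r i j ∧ A.X i < A.Y j → b i ≤ q j) :
    ∃ c : ι → κ, (∀ i, b i = q (c i)) ∧ ∀ i j i' j', (i = r ∨ j = c i) → (i' = r ∨ j' = c i') →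
      ¬ A.Cross i j i' j' := by
  have hex : ∀ i, ∃ j, b i = q j := fun i => by
    rcases h1 i with h | ⟨j, -, h⟩
    exacts [⟨l, h⟩, ⟨j, h⟩]
  choose c hc using hex
  refine ⟨c, hc, ?_⟩
  have hplane := plane_of_choice hrX hrY hinj hq (c := c) ?_ ?_
  · obtain ⟨p1, p2⟩ := hplane
    have hstar : ∀ i j i' j', i = r → (i' = r ∨ j' = c i') → ¬ A.Cross i j i' j' := by
      rintro i j i' j' rfl h hcr
      by_cases hi' : i' = i
      · subst hi'
        exact not_cross_left _ _ _ hcr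
      · obtain rfl := h.resolve_left hi'
        exact p1 i' hi' j hcr.symm
    intro i j i' j' h h' hcr
    by_cases hi : i = r
    · exact hstar i j i' j' hi h' hcr
    by_cases hi' : i' = r
    · exact hstar i' j' i j hi' h hcr.symm
    obtain rfl := h.resolve_left hi
    obtain rfl := h'.resolve_left hi'
    exact p2 i hi i' hi' hcr
  · rintro i - ⟨j, hj1, hj2⟩
    have hle : ∀ j, A.X i < A.Y j → A.Clear r i j → q (c i) ≤ q j := fun j a1 a2 =>
      (hc i) ▸ h2 i j ⟨a2, a1⟩
    rcases h1 i with h | ⟨j', ⟨a1, a2⟩, h⟩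
    -- The entry may equal the default although a candidate `j` exists. Then `q l ≤ q j ≤ q l`, so
    -- the default is itself the first candidate.
    · have : c i = j := hinj (le_antisymm (hle j hj1 hj2) (by rw [← hc i, h]; exact hl j))
      rw [this] at hle ⊢
      exact ⟨hj1, hj2, hle⟩
    · have : c i = j' := hinj (by rw [← hc i, h])
      rw [this] at hle ⊢
      exact ⟨a2, a1, hle⟩
  · intro i _ hn j
    rcases h1 i with h | ⟨j', ⟨a1, a2⟩, h⟩
    · rw [← hc i, h]; exact hl j
    · exact absurd ⟨j', a2, a1⟩ hn

end MonoFamily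

/-! ### Layout of the input word list -/

theorem List.length_flatMap_range_add_le {f : ℕ → List ℕ} {i k : ℕ} (hk : i < k) :
    ((List.range i).flatMap f).length + (f i).length ≤ ((List.range k).flatMap f).length := by
  induction k, hk using Nat.le_induction with
  | base => simp [List.range_succ]
  | succ k hk ih =>
    rw [List.range_succ, List.flatMap_append, List.length_append]
    omega

theorem List.getD_flatMap_range {f : ℕ → List ℕ} {m i q : ℕ} (hi : i < m)
    (hq : q < (f i).length) :
    ((List.range m).flatMap f).getD (((List.range i).flatMap f).length + q) 0 =
      (f i).getD q 0 := by
  induction m with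
  | zero => omega
  | succ m ih =>
    rw [List.range_succ, List.flatMap_append, List.flatMap_singleton]
    rcases Nat.lt_succ_iff_lt_or_eq.1 hi with h | rfl
    · have := List.length_flatMap_range_add_le (f := f) h
      rw [List.getD_append _ _ _ _ (by omega), ih h]
    · rw [List.getD_append_right _ _ _ _ (by omega), Nat.add_sub_cancel_left]

theorem edgeListCode_length {m n : ℕ} (L : List (BEdge m n)) :
    (edgeListCode L).length = 2 * L.length := by
  induction L with
  | nil => rfl
  | cons e L ih => simp only [edgeListCode, List.flatMap_cons, List.length_append] at ih ⊢; simp; omega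

theorem edgeListCode_getD {m n : ℕ} (L : List (BEdge m n)) (k : ℕ) (hk : k < L.length) :
    (edgeListCode L).getD (2 * k) 0 = L[k].1 ∧ (edgeListCode L).getD (2 * k + 1) 0 = L[k].2 := by
  induction L generalizing k with
  | nil => simp at hk
  | cons e L ih =>
    cases k with
    | zero => simp [edgeListCode]
    | succ k =>
      have := ih k (by simpa using hk)
      simpa [edgeListCode, Nat.mul_succ] using this

theorem vertexCode_injective {m n : ℕ} : Function.Injective (vertexCode (m := m) (n := n)) := by
  rintro (i | j) (i' | j') h <;> simp only [vertexCode] at h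
  · rw [Fin.ext h]
  · omega
  · omega
  · rw [Fin.ext (Nat.add_left_cancel h)]

theorem vertexCode_lt {m n : ℕ} (v : BVertex m n) : vertexCode v < m + n := by
  rcases v with i | j <;> simp only [vertexCode] <;> omega

theorem exists_vertexCode_eq {m n v : ℕ} (hv : v < m + n) :
    ∃ u : BVertex m n, vertexCode u = v := by
  by_cases h : v < m
  · exact ⟨Sum.inl ⟨v, h⟩, rfl⟩
  · exact ⟨Sum.inr ⟨v - m, by omega⟩, by simp only [vertexCode]; omega⟩

namespace BDrawingData

variable {m n : ℕ} (X : BDrawingData m n)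

/-- The part of the code that describes the crossings on the edge `(i, j)`. -/
def record (i j : ℕ) : List ℕ :=
  if h : i < m ∧ j < n then
    (X.crossings (⟨i, h.1⟩, ⟨j, h.2⟩)).length :: edgeListCode (X.crossings (⟨i, h.1⟩, ⟨j, h.2⟩))
  else []

/-- The address of the part of the code that describes the crossings on the edge `(i, j)`. -/
def address (i j : ℕ) : ℕ :=
  2 + (m + n) + m * (2 * n) +
    ((List.range i).flatMap fun i' => (List.range n).flatMap (X.record i')).length +
    ((List.range j).flatMap (X.record i)).length

/-- The position of the vertex with code `v`. -/
def position (v : ℕ) : ℕ := (X.order.map vertexCode).idxOf v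

theorem record_of_lt (i : Fin m) (j : Fin n) :
    X.record i j = (X.crossings (i, j)).length :: edgeListCode (X.crossings (i, j)) := by
  rw [record, dif_pos ⟨i.2, j.2⟩]

theorem code_crossings_eq : ((List.finRange m).flatMap fun i => (List.finRange n).flatMap fun j =>
    (X.crossings (i, j)).length :: edgeListCode (X.crossings (i, j))) =
    (List.range m).flatMap fun i => (List.range n).flatMap (X.record i) := by
  rw [← List.map_coe_finRange_eq_range (n := m), List.flatMap_map]
  congr 1
  funext i
  rw [← List.map_coe_finRange_eq_range (n := n), List.flatMap_map]
  congr 1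
  funext j
  rw [record_of_lt]

variable {X} {D : BDrawing m n} (hd : X.Describes D)
include hd

theorem Describes.order_length : X.order.length = m + n := by
  have h : X.order.toFinset = Finset.univ := by
    ext v; simp [hd.mem_order v]
  rw [← List.toFinset_card_of_nodup hd.order_nodup, h]
  simp

theorem Describes.rotRed_length (i : Fin m) : (X.rotRed i).length = n := by
  have h : (X.rotRed i).toFinset = Finset.univ := by
    ext v; simp [hd.mem_rotRed i v]
  rw [← List.toFinset_card_of_nodup (hd.rotRed_nodup i), h]
  simp

theorem Describes.rotBlue_length (j : Fin n) : (X.rotBlue j).length = m := by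
  have h : (X.rotBlue j).toFinset = Finset.univ := by
    ext v; simp [hd.mem_rotBlue j v]
  rw [← List.toFinset_card_of_nodup (hd.rotBlue_nodup j), h]
  simp

/-- `R` is the block of rotations. The program jumps over it, so only its length has to be known. -/
theorem Describes.code_eq : ∃ R : List ℕ, R.length = m * (2 * n) ∧
    X.code = [m, n] ++ X.order.map vertexCode ++ R ++
      (List.range m).flatMap fun i => (List.range n).flatMap (X.record i) := by
  refine ⟨(List.finRange m).flatMap (fun i => (X.rotRed i).map fun j => (j : ℕ)) ++
    (List.finRange n).flatMap (fun j => (X.rotBlue j).map fun i => (i : ℕ)), ?_, ?_⟩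
  · have h1 : ∀ i, (X.rotRed i).length = n := hd.rotRed_length
    have h2 : ∀ j, (X.rotBlue j).length = m := hd.rotBlue_length
    simp [List.length_flatMap, h1, h2]
    ring
  · rw [code, code_crossings_eq]
    simp only [List.append_assoc]

theorem Describes.code_length : X.code.length = X.address m 0 := by
  obtain ⟨R, hR, h⟩ := hd.code_eq
  rw [h, address]
  simp [hd.order_length, hR]
  omega

theorem Describes.code_order {k : ℕ} (hk : k < m + n) :
    X.code.getD (2 + k) 0 = vertexCode (X.order[k]'(hd.order_length ▸ hk)) := by
  obtain ⟨R, hR, h⟩ := hd.code_eq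
  have hk' : k < X.order.length := hd.order_length ▸ hk
  rw [h, List.append_assoc, List.append_assoc, List.getD_append_right _ _ _ _ (by simp),
    List.getD_append _ _ _ _ (by simpa using hk')]
  simp [hk']

theorem Describes.code_record {i j q : ℕ} (hi : i < m) (hj : j < n)
    (hq : q < (X.record i j).length) :
    X.code.getD (X.address i j + q) 0 = (X.record i j).getD q 0 := by
  obtain ⟨R, hR, h⟩ := hd.code_eq
  have h1 : ([m, n] ++ X.order.map vertexCode ++ R).length = 2 + (m + n) + m * (2 * n) := by
    simp [hd.order_length, hR]
    omega
  have h2 := List.getD_flatMap_range (f := X.record i) hj hq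
  have h3 : ((List.range j).flatMap (X.record i)).length + q <
      ((List.range n).flatMap (X.record i)).length := by
    have := List.length_flatMap_range_add_le (f := X.record i) hj
    omega
  have h4 := List.getD_flatMap_range (f := fun i => (List.range n).flatMap (X.record i)) hi h3
  rw [h, List.getD_append_right _ _ _ _ (by rw [h1, address]; omega), h1, ← h2, ← h4]
  congr 1
  rw [address]
  omega

theorem Describes.code_count (i : Fin m) (j : Fin n) :
    X.code.getD (X.address i j) 0 = (X.crossings (i, j)).length := by
  have := hd.code_record (q := 0) i.2 j.2 (by simp [record_of_lt])
  rw [add_zero] at this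
  rw [this]
  simp [record_of_lt]

theorem Describes.code_entry (i : Fin m) (j : Fin n) {k : ℕ}
    (hk : k < (X.crossings (i, j)).length) :
    X.code.getD (X.address i j + 1 + 2 * k) 0 = (X.crossings (i, j))[k].1 ∧
      X.code.getD (X.address i j + 1 + (2 * k + 1)) 0 = (X.crossings (i, j))[k].2 := by
  obtain ⟨h1, h2⟩ := edgeListCode_getD _ k hk
  have hq : ∀ q < 2 * (X.crossings (i, j)).length, X.code.getD (X.address i j + 1 + q) 0 =
      (edgeListCode (X.crossings (i, j))).getD q 0 := fun q hq => by
    rw [add_assoc, Nat.add_comm 1, hd.code_record i.2 j.2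
      (by simp [record_of_lt, edgeListCode_length, hq])]
    simp [record_of_lt]
  exact ⟨by rw [hq _ (by omega), h1], by rw [hq _ (by omega), h2]⟩

theorem Describes.input (hm : 0 < m) (hn : 0 < n) {r : BVertex m n}
    (hr : X.order.head? = some r) :
    ShootingStarProgram.Input m n X.code.length (vertexCode r) (fun a => X.code.getD a 0)
      X.position X.address := by
  have hlen : (X.order.map vertexCode).length = m + n := by rw [List.length_map, hd.order_length]
  have hnd : (X.order.map vertexCode).Nodup := hd.order_nodup.map vertexCode_injective
  have hmem : ∀ v < m + n, v ∈ X.order.map vertexCode := fun v hv => by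
    obtain ⟨u, rfl⟩ := exists_vertexCode_eq hv
    exact List.mem_map_of_mem (hd.mem_order u)
  have hord : ∀ k (hk : k < m + n), X.code.getD (2 + k) 0 =
      (X.order.map vertexCode)[k]'(hlen ▸ hk) := fun k hk => by
    rw [hd.code_order hk, List.getElem_map]
  have hpos : ∀ v < m + n, X.position v < m + n := fun v hv => by
    rw [← hlen]; exact List.idxOf_lt_length_of_mem (hmem v hv)
  obtain ⟨R, hR, hcode⟩ := hd.code_eq
  refine
    { m_pos := hm
      n_pos := hn
      mem_zero := by simp [hcode]
      mem_one := by simp [hcode]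
      mem_two := ?_
      order_lt := fun k hk => by rw [hd.code_order hk]; exact vertexCode_lt _
      pos_order := fun k hk => by
        simp only [hord k hk]
        exact hnd.idxOf_getElem k _
      pos_lt := hpos
      order_pos := fun v hv => by
        simp only [hord _ (hpos v hv)]
        exact List.getElem_idxOf _
      off_zero := by simp [address]
      off_succ := fun i hi j hj => ?_
      off_row := fun i hi => by simp [address, List.range_succ]; omega
      off_last := hd.code_length.symm
      entry_lt := fun i hi j hj k hk => ?_ }
  · have := hd.code_order (k := 0) (by omega)
    rw [add_zero] at this
    rw [this]
    congr 1
    rw [List.head?_eq_getElem?, List.getElem?_eq_some_iff] at hr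
    exact hr.2
  · rw [hd.code_count ⟨i, hi⟩ ⟨j, hj⟩]
    simp [address, List.range_succ, record, hi, hj, edgeListCode_length]
    omega
  · rw [hd.code_count ⟨i, hi⟩ ⟨j, hj⟩] at hk
    rw [(hd.code_entry ⟨i, hi⟩ ⟨j, hj⟩ hk).2]
    exact Fin.is_lt _

/-- Red codes are below `m` and blue codes are not, so comparing the red index and the shifted blue
index with the root's code tests incidence without knowing the root's class. -/
theorem Describes.hit_iff {r : BVertex m n} (i : Fin m) (j : Fin n) :
    ShootingStarProgram.Hit m (vertexCode r) (fun a => X.code.getD a 0) X.address i j ↔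
      ∃ f, D.Crosses (i, j) f ∧ BIncident f r := by
  simp only [ShootingStarProgram.Hit, ShootingStarProgram.Hits, hd.code_count i j]
  have hinc : ∀ f : BEdge m n, BIncident f r ↔
      (f.1 : ℕ) = vertexCode r ∨ (f.2 : ℕ) + m = vertexCode r := fun f => by
    rw [BIncident, ← vertexCode_injective.eq_iff, ← vertexCode_injective.eq_iff, eq_comm,
      @eq_comm _ (vertexCode r), Nat.add_comm]
    rfl
  constructor
  · rintro ⟨k, hk, h⟩
    rw [(hd.code_entry i j hk).1, (hd.code_entry i j hk).2] at h
    exact ⟨_, (hd.mem_crossings _ _).1 (List.getElem_mem hk), (hinc _).2 h⟩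
  · rintro ⟨f, hf, hfr⟩
    obtain ⟨k, hk, rfl⟩ := List.getElem_of_mem ((hd.mem_crossings _ _).2 hf)
    refine ⟨k, hk, ?_⟩
    rw [(hd.code_entry i j hk).1, (hd.code_entry i j hk).2]
    exact (hinc _).1 hfr

theorem Describes.position_spec (v : BVertex m n) : ∃ h : X.position (vertexCode v) < X.order.length,
    X.order[X.position (vertexCode v)] = v := by
  have h := List.idxOf_lt_length_of_mem (List.mem_map_of_mem (f := vertexCode) (hd.mem_order v))
  refine ⟨by rwa [List.length_map] at h, vertexCode_injective ?_⟩
  have := List.getElem_idxOf h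
  rwa [List.getElem_map] at this

theorem Describes.position_injective : 
    Function.Injective fun v : BVertex m n => X.position (vertexCode v) := by
  intro u v huv
  obtain ⟨h1, h2⟩ := hd.position_spec u
  obtain ⟨h3, h4⟩ := hd.position_spec v
  rw [← h2, ← h4]
  congr 1

theorem Describes.le_of_position_lt {u v : BVertex m n}
    (h : X.position (vertexCode u) < X.position (vertexCode v)) : (D.pt u).1 ≤ (D.pt v).1 := by
  obtain ⟨h1, h2⟩ := hd.position_spec u
  obtain ⟨h3, h4⟩ := hd.position_spec v
  have := List.pairwise_iff_getElem.1 hd.order_sorted _ _ h1 h3 h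
  rwa [h2, h4] at this

/-- Arbitrary tie-breaking makes this false for equal abscissas; the endpoints of an edge never tie,
by `abscissa_ne`. -/
theorem Describes.position_lt_iff {u v : BVertex m n} (hne : (D.pt u).1 ≠ (D.pt v).1) :
    X.position (vertexCode u) < X.position (vertexCode v) ↔ (D.pt u).1 < (D.pt v).1 := by
  refine ⟨fun h => lt_of_le_of_ne (hd.le_of_position_lt h) hne, fun h => ?_⟩
  by_contra hc
  rcases (not_lt.1 hc).eq_or_lt with h' | h'
  · exact hne (by rw [hd.position_injective h'])
  · exact absurd h (not_lt.2 (hd.le_of_position_lt h'))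

theorem Describes.root_le {r : BVertex m n} (hr : X.order.head? = some r) (v : BVertex m n) :
    (D.pt r).1 ≤ (D.pt v).1 := by
  obtain ⟨l, hl⟩ := List.head?_eq_some_iff.1 hr
  have hv := hd.mem_order v
  have hs := hd.order_sorted
  rw [hl] at hv hs
  rcases List.mem_cons.1 hv with rfl | hv
  · exact le_rfl
  · exact List.rel_of_pairwise_cons hs hv

end BDrawingData

/-! ### Correctness of the output and the main theorem -/

open ShootingStarProgram

theorem List.flatMap_filter_eq {α β : Type*} (p : α → Prop) [DecidablePred p] (g : α → List β)
    (l : List α) : (l.filter p).flatMap g = l.flatMap fun x => if p x then g x else [] := by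
  induction l with
  | nil => rfl
  | cons x l ih => by_cases h : p x <;> simp [h, ih]

/-- The output of the program as a list of edges. -/
theorem exists_edgeList (m n root : ℕ) (pos b : ℕ → ℕ) : ∃ L : List (BEdge m n),
    tableOutput m n root pos b m = edgeListCode L ∧ L.Nodup ∧
      ∀ e : BEdge m n, e ∈ L ↔ Sel m root pos b e.1 e.2 := by
  classical
  refine ⟨(List.finRange m ×ˢ List.finRange n).filter fun e => Sel m root pos b e.1 e.2, ?_,
    ((List.nodup_finRange m).product (List.nodup_finRange n)).filter _, fun e => ?_⟩
  swap
  · rw [List.mem_filter, decide_eq_true_iff, and_iff_right]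
    exact List.mem_product.2 ⟨List.mem_finRange _, List.mem_finRange _⟩
  rw [edgeListCode, List.flatMap_filter_eq]
  simp only [SProd.sprod, List.product, List.flatMap_assoc, List.flatMap_map]
  rw [tableOutput, ← List.map_coe_finRange_eq_range (n := m), List.flatMap_map]
  congr 1
  funext i
  rw [rowOutput, ← List.map_coe_finRange_eq_range (n := n), List.flatMap_map]

section

variable {m n : ℕ} {D : BDrawing m n} {X : BDrawingData m n} {b : ℕ → ℕ} {last : ℕ}

theorem isShootingStar_red (hs : D.IsSimple) (hm : D.IsXMonotone) (hd : X.Describes D) {r : Fin m}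
    (hr : X.order.head? = some (Sum.inl r)) {l : BVertex m n}
    (hl : IsFar m (vertexCode (m := m) (n := n) (Sum.inl r)) (vertexCode l))
    (hmax : ∀ v : BVertex m n, IsFar m (vertexCode (m := m) (n := n) (Sum.inl r)) (vertexCode v) →
      X.position (vertexCode v) ≤ X.position (vertexCode l))
    (hb : IsBest (Cand m (vertexCode (m := m) (n := n) (Sum.inl r)) (fun a => X.code.getD a 0)
      X.position X.address) X.position m n (vertexCode (m := m) (n := n) (Sum.inl r))
      (X.position (vertexCode l)) (fun i j => i < m ∧ j < n) b) {S : Set (BEdge m n)}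
    (hS : ∀ e : BEdge m n, e ∈ S ↔
      Sel m (vertexCode (m := m) (n := n) (Sum.inl r)) X.position b e.1 e.2) :
    D.IsShootingStar (Sum.inl r) S := by
  have hlt : vertexCode (m := m) (n := n) (Sum.inl r) < m := r.2
  have hne : ∀ i j, (D.pt (Sum.inl i)).1 ≠ (D.pt (Sum.inr j)).1 := fun i j =>
    BDrawing.abscissa_ne hs hm (i, j)
  obtain ⟨l, rfl⟩ : ∃ j, l = Sum.inr j := by
    rcases l with i | j
    · simp [IsFar, hlt] at hl
      exact absurd i.2 (not_lt.2 hl)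
    · exact ⟨j, rfl⟩
  -- The machine's test means exactly "clear and leading to the right", which turns the computed
  -- table into the one required by `exists_choice_of_table`.
  have hcand : ∀ (i : Fin m) (j : Fin n), Cand m (vertexCode (m := m) (n := n) (Sum.inl r))
      (fun a => X.code.getD a 0) X.position X.address i j ↔
      (D.toMonoFamily hs hm).Clear r i j ∧ (D.pt (Sum.inl i)).1 < (D.pt (Sum.inr j)).1 := by
    intro i j
    rw [← hd.position_lt_iff (hne i j), Cand, hd.hit_iff, near, far, if_pos hlt, if_pos hlt]
    refine and_congr ?_ Iff.rfl
    constructor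
    · intro h j' hc
      exact h ⟨(r, j'), (BDrawing.toMonoFamily_cross hs hm).1 hc, Or.inl rfl⟩
    · rintro h ⟨⟨i', j'⟩, hc, hi'⟩
      obtain rfl : r = i' := by simpa [BIncident] using hi'
      exact h j' ((BDrawing.toMonoFamily_cross hs hm).2 hc)
  have hex := MonoFamily.exists_choice_of_table (A := D.toMonoFamily hs hm) (r := r)
    (fun i => hd.root_le hr (Sum.inl i))
    (fun j => lt_of_le_of_ne (hd.root_le hr (Sum.inr j)) (hne r j))
    (q := fun j => X.position (vertexCode (Sum.inr j : BVertex m n)))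
    (hd.position_injective.comp Sum.inr_injective) (fun _ _ h => hd.le_of_position_lt h)
    (b := fun i => b i) (l := l)
    (fun j => hmax _ (by rw [IsFar, if_pos hlt]; exact Nat.le_add_right _ _)) ?_ ?_
  · obtain ⟨c, hc, hplane⟩ := hex
    have hS' : ∀ e : BEdge m n, e ∈ S ↔ e.1 = r ∨ e.2 = c e.1 := by
      intro e
      rw [hS, Sel, near, far, if_pos hlt, if_pos hlt, hc]
      refine or_congr Fin.ext_iff.symm ?_
      rw [eq_comm (a := e.2)]
      exact (hd.position_injective.comp Sum.inr_injective).eq_iff (a := c e.1) (b := e.2)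
    exact BDrawing.isShootingStar_inl hS' fun e he f hf hef =>
      hplane _ _ _ _ ((hS' e).1 he) ((hS' f).1 hf) ((BDrawing.toMonoFamily_cross hs hm).2 hef)
  · intro i
    rcases (hb i (by omega)).1 with h | ⟨i', j', ⟨hi', hj'⟩, hc, hn, h⟩
    · exact Or.inl h
    · rw [near, if_pos hlt] at hn
      rw [far, if_pos hlt] at h
      obtain rfl : i = ⟨i', hi'⟩ := Fin.ext hn.symm
      exact Or.inr ⟨⟨j', hj'⟩, (hcand ⟨i', hi'⟩ ⟨j', hj'⟩).1 hc, h⟩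
  · intro i j hij
    have := (hb i (by omega)).2.2 i j ⟨i.2, j.2⟩ ((hcand i j).2 hij) (by rw [near, if_pos hlt])
    rwa [far, if_pos hlt] at this

/-- The roles of the classes are exchanged by `toMonoFamilySwap`; table entries now sit at the
shifted codes `m + j`. -/
theorem isShootingStar_blue (hs : D.IsSimple) (hm : D.IsXMonotone) (hd : X.Describes D) {r : Fin n}
    (hr : X.order.head? = some (Sum.inr r)) {l : BVertex m n}
    (hl : IsFar m (vertexCode (m := m) (n := n) (Sum.inr r)) (vertexCode l))
    (hmax : ∀ v : BVertex m n, IsFar m (vertexCode (m := m) (n := n) (Sum.inr r)) (vertexCode v) →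
      X.position (vertexCode v) ≤ X.position (vertexCode l))
    (hb : IsBest (Cand m (vertexCode (m := m) (n := n) (Sum.inr r)) (fun a => X.code.getD a 0)
      X.position X.address) X.position m n (vertexCode (m := m) (n := n) (Sum.inr r))
      (X.position (vertexCode l)) (fun i j => i < m ∧ j < n) b) {S : Set (BEdge m n)}
    (hS : ∀ e : BEdge m n, e ∈ S ↔
      Sel m (vertexCode (m := m) (n := n) (Sum.inr r)) X.position b e.1 e.2) :
    D.IsShootingStar (Sum.inr r) S := by
  have hlt : ¬ vertexCode (m := m) (n := n) (Sum.inr r) < m := by simp [vertexCode]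
  have hne : ∀ i j, (D.pt (Sum.inr j)).1 ≠ (D.pt (Sum.inl i)).1 := fun i j =>
    (BDrawing.abscissa_ne hs hm (i, j)).symm
  obtain ⟨l, rfl⟩ : ∃ i, l = Sum.inl i := by
    rcases l with i | j
    · exact ⟨i, rfl⟩
    · rw [IsFar, if_neg hlt] at hl
      exact absurd hl (Nat.not_lt.2 (Nat.le_add_right _ _))
  have hcand : ∀ (i : Fin m) (j : Fin n), Cand m (vertexCode (m := m) (n := n) (Sum.inr r))
      (fun a => X.code.getD a 0) X.position X.address i j ↔
      (D.toMonoFamilySwap hs hm).Clear r j i ∧ (D.pt (Sum.inr j)).1 < (D.pt (Sum.inl i)).1 := by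
    intro i j
    rw [← hd.position_lt_iff (hne i j), Cand, hd.hit_iff, near, far, if_neg hlt, if_neg hlt]
    refine and_congr ?_ Iff.rfl
    constructor
    · intro h i' hc
      exact h ⟨(i', r), (BDrawing.toMonoFamilySwap_cross hs hm (e := (i, j)) (f := (i', r))).1 hc,
        Or.inr rfl⟩
    · rintro h ⟨⟨i', j'⟩, hc, hi'⟩
      obtain rfl : r = j' := by simpa [BIncident] using hi'
      exact h i' ((BDrawing.toMonoFamilySwap_cross hs hm (e := (i, j)) (f := (i', r))).2 hc)
  have hex := MonoFamily.exists_choice_of_table (A := D.toMonoFamilySwap hs hm)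
    (r := r) (fun j => hd.root_le hr (Sum.inr j))
    (fun i => lt_of_le_of_ne (hd.root_le hr (Sum.inl i)) (hne i r))
    (q := fun i => X.position (vertexCode (Sum.inl i : BVertex m n)))
    (hd.position_injective.comp Sum.inl_injective) (fun _ _ h => hd.le_of_position_lt h)
    (b := fun j => b (m + j)) (l := l)
    (fun i => hmax _ (by rw [IsFar, if_neg hlt]; exact i.2)) ?_ ?_
  · obtain ⟨c, hc, hplane⟩ := hex
    have hS' : ∀ e : BEdge m n, e ∈ S ↔ e.2 = r ∨ e.1 = c e.2 := by
      intro e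
      rw [hS, Sel, near, far, if_neg hlt, if_neg hlt, hc]
      refine or_congr (Nat.add_left_cancel_iff.trans Fin.ext_iff.symm) ?_
      rw [eq_comm (a := e.1)]
      exact (hd.position_injective.comp Sum.inl_injective).eq_iff (a := c e.2) (b := e.1)
    exact BDrawing.isShootingStar_inr hS' fun e he f hf hef =>
      hplane _ _ _ _ ((hS' e).1 he) ((hS' f).1 hf) ((BDrawing.toMonoFamilySwap_cross hs hm).2 hef)
  · intro j
    rcases (hb (m + j) (by omega)).1 with h | ⟨i', j', ⟨hi', hj'⟩, hc, hn, h⟩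
    · exact Or.inl h
    · rw [near, if_neg hlt] at hn
      rw [far, if_neg hlt] at h
      obtain rfl : j = ⟨j', hj'⟩ := Fin.ext (Nat.add_left_cancel hn).symm
      exact Or.inr ⟨⟨i', hi'⟩, (hcand ⟨i', hi'⟩ ⟨j', hj'⟩).1 hc, h⟩
  · intro j i hij
    have := (hb (m + j) (by omega)).2.2 i j ⟨i.2, j.2⟩ ((hcand i j).2 hij)
      (by rw [near, if_neg hlt])
    rwa [far, if_neg hlt] at this

end

/-- One fixed program computes, from the combinatorial description of any monotone drawing of
`K_{m,n}`, a shooting star rooted at the leftmost vertex, in a number of steps linear in the length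
of the input and with words of logarithmic bit length. -/
theorem theorem2 :
    ∃ (P : RamProg) (C : ℕ), ∀ (m n : ℕ), 0 < m → 0 < n →
      ∀ D : BDrawing m n, D.IsSimple → D.IsXMonotone →
      ∀ X : BDrawingData m n, X.Describes D →
        ∃ (t : ℕ) (s : RamState) (r : BVertex m n) (L : List (BEdge m n)),
          t ≤ C * X.code.length ∧
          RamExec (C * X.code.length) P (RamState.start X.code) t s ∧
          s.output = edgeListCode L ∧ L.Nodup ∧
          X.order.head? = some r ∧
          D.IsShootingStar r {e | e ∈ L} := by
  refine ⟨program, 1000, fun m n hm hn D hs hmono X hd => ?_⟩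
  have hlen := hd.order_length
  obtain ⟨r, hr⟩ : ∃ r, X.order.head? = some r := by
    rcases h : X.order with _ | ⟨r, l⟩
    · rw [h] at hlen
      simp at hlen
      omega
    · exact ⟨r, rfl⟩
  have hin := hd.input hm hn hr
  obtain ⟨last, b, h1, h2, h3, h4, t, s, hexec, ht, hout⟩ := wp_program hin
    (s := RamState.start X.code) rfl (fun _ => rfl)
  obtain ⟨L, hL, hnd, hmem⟩ := exists_edgeList m n (vertexCode r) X.position b
  refine ⟨t, s, r, L, ht, hexec, hout.trans hL, hnd, hr, ?_⟩
  -- The default is stored as a position; here it is turned back into the vertex `l` at that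
  -- position.
  have hlast : ∃ l : BVertex m n, X.code.getD (2 + last) 0 = vertexCode l :=
    ⟨_, hd.code_order h2⟩
  obtain ⟨l, hl⟩ := hlast
  simp only [hl] at h1
  have hpos : X.position (vertexCode l) = last := by rw [← hl]; exact hin.pos_order _ h2
  have hmax : ∀ v : BVertex m n, IsFar m (vertexCode r) (vertexCode v) →
      X.position (vertexCode v) ≤ X.position (vertexCode l) := by
    intro v hv
    rw [hpos]
    refine h3 _ (hin.pos_lt _ (vertexCode_lt v)) ?_
    rwa [hin.order_pos _ (vertexCode_lt v)]
  rw [← hpos] at h4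
  rcases r with r | r
  · exact isShootingStar_red hs hmono hd hr h1 hmax h4 hmem
  · exact isShootingStar_blue hs hmono hd hr h1 hmax h4 hmem
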